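/- Let $\beta\in(1,2)$ be an algebraic integer none of whose Galois conjugates has modulus $1$ (this covers every $\beta>1$ that is a root of a polynomial with coefficients in $\{-1,0,1\}$ and has no conjugate of modulus $1$). Let $\beta_1=\beta,\beta_2,\dots,\beta_m$ be the conjugates of $\beta$, let $\mathbb K=\prod_i\mathbb F_i$ with $\mathbb F_i=\mathbb R$ if $\beta_i\in\mathbb R$ and $\mathbb F_i=\mathbb C$ otherwise, let $\bar\beta=(\beta_1,\dots,\beta_m)\in\mathbb K$ (with coordinatewise products), and for $i\in\mathbb Z$ let $T_i(x)=\bar\beta x+i$, where $i$ is added in every coordinate. Let $\bar X=\{\sum_{i=1}^n c_i\bar\beta^{\,n-i}: n\in\mathbb N,\ c_i\in\{-1,0,1\}\}$ and $X=\{\sum_{i=1}^n c_i\beta^{n-i}: n\in\mathbb N,\ c_i\in\{-1,0,1\}\}\subset\mathbb R$. Let $\bar{\mathcal N}_n(x)$ be the number of pairs of words $a,b\in\{0,1\}^n$ with $\sum_{i=1}^n(a_i-b_i)\bar\beta^{\,n-i}=x$, for $x\in\mathbb K$, and $\mathcal N_n(x)$, for $x\in\mathbb R$, the same with $\beta$ in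 place of $\bar\beta$. The set $\bar X_1$ of all $x\in\bar X$ with $|x_i|<1/\bigl||\beta_i|-1\bigr|$ for all $i$ is finite. Let $\lambda$ be the spectral radius of the matrix indexed by $\bar X_1$ whose $(x,y)$ entry is $1$ if $y=T_{1}(x)$ or $y=T_{-1}(x)$, $2$ if $y=T_0(x)$, and $0$ otherwise. Then $\lambda>1$, and the limits $\bar\mu(x)=\lim_n\lambda^{-n}\bar{\mathcal N}_n(x)$ and $\mu(x)=\lim_n\lambda^{-n}\mathcal N_n(x)$ exist for all $x\in\mathbb K$, respectively $x\in\mathbb R$, and are positive on $\bar X$, respectively $X$. Let $\Delta$ be the set of the differences $x-y$ of points $x,y\in\bar X$ for which there are an $n$ and words $c,d\in\{-1,0,1\}^n$ with $T_{c_n}\circ\cdots\circ T_{c_1}(x)=T_{d_n}\circ\cdots\circ T_{d_1}(y)$. This set is finite and contains $0$. Write $\Delta=\{v_1,\dots,v_k\}$ with distinct $v_i$ and $v_1=0$, let $W=(\bar\mu(v_1),\dots,\bar\mu(v_k))$, and for $i\in\{-1,0,1\}$ let $A_i$ be the $k\times k$ matrix whose $(m,l)$ entry is $1$ if $T_{j-i}(v_m)=v_l$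 for some $j\in\{-1,1\}$, $2$ if $T_{-i}(v_m)=v_l$, and $0$ otherwise. Then $WA_0=\lambda W$, and $\lambda$ is the spectral radius of $A_0$. For every $n$ and every $c_1\cdots c_n\in\{-1,0,1\}^n$, with $\bar x=\sum_{i=1}^n c_i\bar\beta^{\,n-i}$ and $x=\sum_{i=1}^n c_i\beta^{n-i}$, $$\bar\mu(\bar x)=\mu(x)=\lambda^{-n}(WA_{c_1}\cdots A_{c_n})_1,$$ and for every $i\in\{1,\dots,k\}$ $$(WA_{c_1}\cdots A_{c_n})_i=\lambda^n\bar\mu(\bar x+v_i)=\lambda^n\mu(x+d_i),$$ where $d_i\in\mathbb R$ is the coordinate of $v_i$ that belongs to $\beta_1=\beta$. Golden mean. Let $\beta=\phi=(1+\sqrt5)/2$ and take $T_i(x)=\phi x+i$ on $\mathbb R$. Let $V$ be the set of the points $T_{e_m}\circ\cdots\circ T_{e_1}(0)$ with $m\in\mathbb N$ and $e_1,\dots,e_m\in\{-2,-1,0,1,2\}$ that lie in $(-2\phi,2\phi)$. It is finite and contains $0$. Write $V=\{v_1,\dots,v_k\}$ with distinct $v_i$ and $v_1=0$, let $M_{-1},M_0,M_1$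 be defined by the same rule as $A_{-1},A_0,A_1$ from these $v_i$, and let $W=(\mu(v_1),\dots,\mu(v_k))$. Then $W$ is a left eigenvector of $M_0$ for the eigenvalue $\lambda$, which is the spectral radius of $M_0$, and for every code $x=\sum_{i=1}^n c_i\phi^{n-i}$ with $c_i\in\{-1,0,1\}$ one has $\mu(x)=\lambda^{-n}(WM_{c_1}\cdots M_{c_n})_1$ and $(WM_{c_1}\cdots M_{c_n})_i=\lambda^n\mu(x+v_i)$ for every $i$. -/

import Mathlib

open Filter Topology

noncomputable section

namespace SpectraMeasure

/-! Constructions over an arbitrary commutative ring `E` with a base `b : E`. They are used with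
`E = ℝ`, `b = β`, and with the product `𝕂` of completions, `b = (β₁, …, β_{d+s})`. -/

section General

variable {E : Type*} [CommRing E]

/-- The three digits `-1, 0, 1`. -/
def digits : Set ℤ := {-1, 0, 1}

/-- The map `T_i (x) = b x + i`. -/
def T (b : E) (i : ℤ) (x : E) : E := b * x + (i : E)

/-- `T_{c_n} ∘ ⋯ ∘ T_{c_1} (x)` for a word `c = c_1 ⋯ c_n`. -/
def iterT (b : E) {n : ℕ} (c : Fin n → ℤ) (x : E) : E :=
  (List.ofFn c).foldl (fun y i => T b i y) x

/-- `∑_{i=1}^n c_i b^{n-i}` for a word `c = c_1 ⋯ c_n` (whose letters Lean numbers from `0`). -/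
def codeSum (b : E) {n : ℕ} (c : Fin n → ℤ) : E :=
  ∑ i : Fin n, (c i : E) * b ^ (n - 1 - (i : ℕ))

/-- The spectrum `X_D(b)` of `b` with the alphabet `D`. -/
def spectrumSet (D : Set ℤ) (b : E) : Set E :=
  {x | ∃ (n : ℕ) (c : Fin n → ℤ), (∀ i, c i ∈ D) ∧ codeSum b c = x}

/-- `𝒩_n(x)`: the number of pairs of words `a, a' ∈ {0,1}^n` with
`∑ a_i b^{n-i} - ∑ a'_i b^{n-i} = x`. -/
def count (b : E) (n : ℕ) (x : E) : ℕ :=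
  Nat.card {p : (Fin n → Fin 2) × (Fin n → Fin 2) //
    ∑ i : Fin n, (((p.1 i : ℕ) : E) - ((p.2 i : ℕ) : E)) * b ^ (n - 1 - (i : ℕ)) = x}

/-- The mass `μ(x) = lim 𝒩_n(x) / L^n`. -/
def limitMass (b : E) (L : ℝ) (x : E) : ℝ :=
  limUnder atTop (fun n : ℕ => (count b n x : ℝ) / L ^ n)

/-- The differences `x - y` of points of the spectrum that can be mapped to the same point by
maps `T_{c_n} ∘ ⋯ ∘ T_{c_1}` and `T_{d_n} ∘ ⋯ ∘ T_{d_1}` with digits in `{-1,0,1}`. -/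
def Delta (b : E) : Set E :=
  {v | ∃ x ∈ spectrumSet digits b, ∃ y ∈ spectrumSet digits b,
    (∃ (n : ℕ) (c d : Fin n → ℤ), (∀ i, c i ∈ digits) ∧ (∀ i, d i ∈ digits) ∧
      iterT b c x = iterT b d y) ∧ v = x - y}

open Classical in
/-- The transition matrix `A_i` on the points `v m` (`m : ι`): its entry at `(m, l)` is `1` if
`T_{j-i}(v_m) = v_l` for some `j ∈ {-1,1}`, it is `2` if `T_{-i}(v_m) = v_l`, and `0` otherwise. -/
def transMatrix {ι : Type*} (b : E) (v : ι → E) (i : ℤ) : Matrix ι ι ℝ :=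
  Matrix.of fun m l =>
    if T b (1 - i) (v m) = v l ∨ T b (-1 - i) (v m) = v l then 1
    else if T b (-i) (v m) = v l then 2
    else 0

end General

open Classical in
/-- The spectral radius of a real square matrix: the largest modulus of a complex eigenvalue. -/
def matRadius {ι : Type*} [Fintype ι] (A : Matrix ι ι ℝ) : ℝ :=
  (spectralRadius ℂ (A.map (fun r : ℝ => (r : ℂ)))).toReal

/-- The Galois conjugates of `β` in `ℂ`, including `β` itself. -/
abbrev GaloisConj (β : ℝ) : Type := {z : ℂ // Polynomial.aeval z (minpoly ℚ β) = 0}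

/-- `β` as one of its own conjugates. -/
def GaloisConj.self (β : ℝ) : GaloisConj β :=
  ⟨(β : ℂ), by
    have h := Polynomial.aeval_algebraMap_apply ℂ β (minpoly ℚ β)
    simpa [minpoly.aeval] using h⟩

/-- The space `𝕂`: the product over the conjugates `z` of `β` of `ℝ` (the real line in `ℂ`) if `z`
is real, and of `ℂ` if it is not. -/
def KSpace (β : ℝ) : Subring (GaloisConj β → ℂ) where
  carrier := {x | ∀ z : GaloisConj β, z.1.im = 0 → (x z).im = 0}
  mul_mem' := by
    intro x y hx hy z hz
    simp [Complex.mul_im, hx z hz, hy z hz]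
  one_mem' := by intro z _; simp
  add_mem' := by
    intro x y hx hy z hz
    simp [hx z hz, hy z hz]
  zero_mem' := by intro z _; simp
  neg_mem' := by
    intro x hx z hz
    simp [hx z hz]

/-- The vector of all conjugates of `β`, a point of `𝕂`. -/
def betaBar (β : ℝ) : KSpace β := ⟨fun z => z.1, fun _ hz => hz⟩

/-- The coordinate of a point of `𝕂` that belongs to `β` itself (a real number). -/
def firstCoord (β : ℝ) (x : KSpace β) : ℝ := (x.1 (GaloisConj.self β)).re

/-- The points `x` of the lifted spectrum with `|x_z| < R / ||z| - 1|` for every conjugate `z`. -/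
def spectrumBox (β R : ℝ) : Set (KSpace β) :=
  {x | x ∈ spectrumSet digits (betaBar β) ∧
    ∀ z : GaloisConj β, ‖x.1 z‖ < R / |‖z.1‖ - 1|}

open Classical in
/-- `λ`: the spectral radius of the matrix `Λ_1` that describes the maps `T_1, T_{-1}` (with
weight 1) and `T_0` (with weight 2) on the finite set of the points of the box with `R = 1`. -/
def lam (β : ℝ) : ℝ :=
  if h : (spectrumBox β 1).Finite then
    haveI : Fintype (spectrumBox β 1) := h.fintype
    matRadius (transMatrix (betaBar β) (fun x : spectrumBox β 1 => (x : KSpace β)) 0)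
  else 0

/-- The masses of the lifted measure on `𝕂`. -/
def muBar (β : ℝ) (x : KSpace β) : ℝ := limitMass (betaBar β) (lam β) x

/-- The masses of the measure on `ℝ`. -/
def mu (β : ℝ) (x : ℝ) : ℝ := limitMass β (lam β) x

/-- For the golden mean `φ`: the points `T_{e_m} ∘ ⋯ ∘ T_{e_1}(0)` in `(-2φ, 2φ)`, where each `e_i`
is a difference of two digits from `{-1,0,1}`. -/
def goldenV : Set ℝ :=
  {x | x ∈ spectrumSet {-2, -1, 0, 1, 2} Real.goldenRatio ∧
    x ∈ Set.Ioo (-(2 * Real.goldenRatio)) (2 * Real.goldenRatio)}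

end SpectraMeasure

end

namespace SpectraMeasure

/-! Read `count β n x` as the weighted number of paths of length n from 0 to x under T_0 (weight 2)
and T_1, T_{-1} (weight 1). By Cauchy–Schwarz it is largest at x = 0. Joining loops at 0 makes
`count β n 0` supermultiplicative. Cutting a loop of length m + n after m steps makes it
submultiplicative up to a constant, because the cut points form the finite set `returnSet`: at
contracting conjugates they are bounded as codes, at expanding ones because they return to 0, and
ℤ[β] has only finitely many points all of whose conjugates are bounded. Hence `count β n 0` is
comparable to L^n for some L (`exists_growth`).

Convergence of the normalized counts comes from renewal theory. Decomposing paths at their last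
visit to 0 gives a renewal equation; it is aperiodic because T_0 fixes 0, and its solution is
bounded and bounded away from 0 (`exists_tendsto_of_renewal`). The limit μ is positive on X, zero
off X, and an eigenfunction of `transfer` with eigenvalue L.

Multiplying a row vector by a transition matrix is applying `transfer`, as soon as the finite index
set contains every preimage that carries mass. Thus each factor A_c turns the masses at t + d_l into
those at βt + c + d_l, up to the factor L, which is the product formula (`vecMul_prod`). For A_0 the
masses form a left eigenvector for L, while entries of A_0^n are bounded by path counts and so by
L^n; hence the spectral radius is L (`matRadius_transMatrix`). On the box X̄_1 this says L = λ; it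
applies equally to Δ and to the golden set.

The computations are made on ℝ, where one can divide by β; finiteness is proved in 𝕂. The two are
linked by the injectivity of the first coordinate on ℤ[β] (`firstCoord_injOn`). -/

/-! ### Renewal sequences and exact exponential growth -/

/-- If `f ≥ 0` is summable and `a` is bounded, then the convolution `∑_{j ≤ n} f_j a_{n-j}` is
controlled along any filter along which all the shifts of `a` converge. -/
theorem tendsto_convolution {f a : ℕ → ℝ} {K : ℝ} {U : Filter ℕ} {l : ℝ} (hU : U ≤ atTop)
    (hf : ∀ j, 0 ≤ f j) (hs : Summable f) (ha : ∀ n, |a n| ≤ K)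
    (hl : ∀ j, Tendsto (fun n => a (n - j)) U (𝓝 l)) :
    Tendsto (fun n => ∑ j ∈ Finset.range (n + 1), f j * a (n - j)) U (𝓝 ((∑' j, f j) * l)) := by
  have hK : 0 ≤ K := (abs_nonneg _).trans (ha 0)
  have key := tendsto_tsum_of_dominated_convergence (𝓕 := U)
    (f := fun n j => if j < n + 1 then f j * a (n - j) else 0) (g := fun j => f j * l)
    (bound := fun j => f j * K) (hs.mul_right K) ?_ ?_
  · rw [tsum_mul_right] at key
    refine key.congr fun n => ?_
    rw [tsum_eq_sum (s := Finset.range (n + 1))]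
    · exact Finset.sum_congr rfl fun j hj => by simp [Finset.mem_range.1 hj]
    · intro j hj
      simp only [Finset.mem_range] at hj
      simp [hj]
  · intro j
    refine ((hl j).const_mul (f j)).congr' ?_
    filter_upwards [hU (eventually_ge_atTop j)] with n hn
    rw [if_pos (by omega)]
  · refine Eventually.of_forall fun n j => ?_
    split_ifs
    · rw [Real.norm_eq_abs, abs_mul, abs_of_nonneg (hf j)]
      exact mul_le_mul_of_nonneg_left (ha _) (hf j)
    · simpa using mul_nonneg (hf j) hK

/-- A bounded solution of a renewal equation that is close to its upper limit at `n + 1` is close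
to it at `n`. -/
theorem tendsto_shift_of_renewal {f a : ℕ → ℝ} {K M : ℝ} {U : Filter ℕ} (hU : U ≤ atTop)
    (hf : ∀ j, 0 ≤ f j) (hs : HasSum f 1) (hf0 : 0 < f 0) (ha : ∀ n, |a n| ≤ K)
    (hren : ∀ n, a (n + 1) = ∑ j ∈ Finset.range (n + 1), f j * a (n - j))
    (hM : ∀ ε > 0, ∀ᶠ n in atTop, a n ≤ M + ε) (hl : Tendsto a U (𝓝 M)) :
    Tendsto (fun n => a (n - 1)) U (𝓝 M) := by
  have hK : 0 ≤ K := (abs_nonneg _).trans (ha 0)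
  rw [tendsto_order]
  refine ⟨fun m hm => ?_, fun m hm => ?_⟩
  swap
  · filter_upwards [hU ((tendsto_sub_atTop_nat 1).eventually (hM ((m - M) / 2) (by linarith)))]
      with n hn
    linarith
  -- The losses below add up to at most ε/4 + ε + ε/2 + ε, which is less than 4ε = f 0 * (M - m).
  · set ε : ℝ := f 0 * (M - m) / 4 with hε
    have hε0 : 0 < ε := by have := sub_pos.2 hm; positivity
    obtain ⟨n₀, hn₀⟩ := eventually_atTop.1 (hM ε hε0)
    -- The excess of a over M + ε. It vanishes from n₀ on, so its convolution with f tends to 0.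
    set b : ℕ → ℝ := fun n => max (a n - M - ε) 0 with hb
    have hbz : ∀ n ≥ n₀, b n = 0 := fun n hn => max_eq_right (by linarith [hn₀ n hn])
    have hbK : ∀ n, |b n| ≤ K + |M| + ε := by
      intro n
      rw [abs_of_nonneg (le_max_right _ _)]
      refine max_le ?_ (by positivity)
      linarith [(abs_le.1 (ha n)).2, neg_abs_le M]
    have hconv := tendsto_convolution (U := atTop) le_rfl hf hs.summable hbK (l := 0)
      (fun j => tendsto_const_nhds.congr' (by
        filter_upwards [eventually_ge_atTop (n₀ + j)] with n hn
        exact (hbz _ (by omega)).symm))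
    rw [mul_zero] at hconv
    have hpart := hs.tendsto_sum_nat
    have hpart1 : Tendsto (fun n => ∑ j ∈ Finset.range (n + 1), f j) atTop (𝓝 1) :=
      hpart.comp (tendsto_add_atTop_nat 1)
    have hpm : Tendsto (fun n => (∑ j ∈ Finset.range (n + 1), f j) * M) atTop (𝓝 M) := by
      simpa using hpart1.mul_const M
    have e1 : ∀ᶠ n in atTop, ∑ j ∈ Finset.range (n + 1), f j * b (n - j) < ε :=
      hconv.eventually_lt_const hε0
    have e2 : ∀ᶠ n in atTop, (∑ j ∈ Finset.range (n + 1), f j) * M < M + ε / 2 :=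
      hpm.eventually_lt_const (by linarith)
    have e3 : ∀ᶠ n in U, M - ε / 4 < a n := hl.eventually_const_lt (by linarith)
    filter_upwards [e3, hU ((tendsto_sub_atTop_nat 1).eventually e1),
      hU ((tendsto_sub_atTop_nat 1).eventually e2), hU (eventually_ge_atTop (n₀ + 1))]
      with n h3 h1 h2 hn
    obtain ⟨n, rfl⟩ : ∃ k, n = k + 1 := ⟨n - 1, by omega⟩
    simp only [Nat.add_sub_cancel] at h1 h2 ⊢
    have hle1 : ∑ j ∈ Finset.range (n + 1), f j ≤ 1 := sum_le_hasSum _ (fun j _ => hf j) hs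
    have hsplit : a (n + 1) ≤ f 0 * (a n - M - ε) +
        ∑ j ∈ Finset.range (n + 1), f j * b (n - j) + (∑ j ∈ Finset.range (n + 1), f j) * (M + ε) := by
      rw [hren, Finset.sum_mul, Finset.sum_range_succ', Finset.sum_range_succ' (fun j => f j * b (n - j)),
        Finset.sum_range_succ' (fun j => f j * (M + ε))]
      have : ∑ k ∈ Finset.range n, f (k + 1) * a (n - (k + 1)) ≤
          ∑ k ∈ Finset.range n, f (k + 1) * b (n - (k + 1)) +
          ∑ k ∈ Finset.range n, f (k + 1) * (M + ε) := by
        rw [← Finset.sum_add_distrib]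
        refine Finset.sum_le_sum fun k _ => ?_
        rw [← mul_add]
        refine mul_le_mul_of_nonneg_left ?_ (hf _)
        have := le_max_left (a (n - (k + 1)) - M - ε) 0
        simp only [hb]; linarith
      have hb0 : 0 ≤ f 0 * b (n - 0) := mul_nonneg (hf 0) (le_max_right _ _)
      simp only [Nat.sub_zero] at hb0 ⊢
      linarith
    have hf1 : f 0 ≤ 1 := le_hasSum hs 0 fun j _ => hf j
    have : f 0 * m < f 0 * a n := by
      have h5 : (∑ j ∈ Finset.range (n + 1), f j) * ε ≤ ε := by nlinarith
      have h4 : 4 * ε = f 0 * (M - m) := by rw [hε]; ring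
      nlinarith
    exact lt_of_mul_lt_mul_left this (hf 0)

/-- The upper limit of a bounded solution of an aperiodic renewal equation with finite mean. -/
theorem limsup_eq_of_renewal {f r a : ℕ → ℝ} {K τ : ℝ} (hf : ∀ j, 0 ≤ f j) (hs : HasSum f 1)
    (hf0 : 0 < f 0) (hr : ∀ j, 0 ≤ r j) (hrs : Summable r) (ha : ∀ n, |a n| ≤ K)
    (hren : ∀ n, a (n + 1) = ∑ j ∈ Finset.range (n + 1), f j * a (n - j))
    (hinv : ∀ n, ∑ j ∈ Finset.range (n + 1), r j * a (n - j) = τ) :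
    (∑' j, r j) * limsup a atTop = τ := by
  have hbdd : IsBoundedUnder (· ≤ ·) atTop a :=
    isBoundedUnder_of ⟨K, fun n => (abs_le.1 (ha n)).2⟩
  have hbdd' : IsBoundedUnder (· ≥ ·) atTop a :=
    isBoundedUnder_of ⟨-K, fun n => (abs_le.1 (ha n)).1⟩
  set M := limsup a atTop with hMdef
  have hM : ∀ ε > 0, ∀ᶠ n in atTop, a n ≤ M + ε := fun ε hε =>
    (eventually_lt_of_limsup_lt (lt_add_of_pos_right M hε) hbdd).mono fun _ h => h.le
  have hcl : MapClusterPt M atTop a := by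
    rw [mapClusterPt_iff_frequently]
    intro s hs
    obtain ⟨ε, hε, hsub⟩ := Metric.mem_nhds_iff.1 hs
    have h1 : ∃ᶠ n in atTop, M - ε < a n :=
      frequently_lt_of_lt_limsup hbdd'.isCoboundedUnder_le (sub_lt_self M hε)
    refine (h1.and_eventually (hM (ε / 2) (by linarith))).mono fun n hn => hsub ?_
    rw [Metric.mem_ball, Real.dist_eq, abs_lt]
    constructor <;> linarith [hn.1, hn.2]
  -- Along U the sequence tends to M; the shift lemma, applied repeatedly, gives the same for every
  -- shift, so `hinv` can be passed to the limit term by term.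
  obtain ⟨U, hU, hUM⟩ := mapClusterPt_iff_ultrafilter.1 hcl
  have hall : ∀ j, Tendsto (fun n => a (n - j)) U (𝓝 M) := by
    intro j
    induction j with
    | zero => simpa using hUM
    | succ j ih =>
      have h2 : map (fun n => n - j) (U : Filter ℕ) ≤ atTop :=
        (map_mono hU).trans (tendsto_sub_atTop_nat j)
      have := tendsto_shift_of_renewal h2 hf hs hf0 ha hren hM (tendsto_map'_iff.2 ih)
      rw [tendsto_map'_iff] at this
      refine this.congr fun n => ?_
      simp [Nat.sub_sub]
  have h3 := tendsto_convolution hU hr hrs ha hall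
  simp only [hinv] at h3
  exact (tendsto_nhds_unique h3 tendsto_const_nhds)

/-- The total mass in a renewal equation whose solution is bounded above and away from zero. -/
theorem hasSum_one_of_renewal {f v : ℕ → ℝ} {δ : ℝ} (hδ : 0 < δ) (hf : ∀ j, 0 ≤ f j)
    (hv0 : v 0 = 1) (hren : ∀ n, v (n + 1) = ∑ j ∈ Finset.range (n + 1), f j * v (n - j))
    (hlow : ∀ n, δ ≤ v n) (hup : ∀ n, v n ≤ 1) : HasSum f 1 := by
  have hv : ∀ n, 0 ≤ v n := fun n => hδ.le.trans (hlow n)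
  have hsum : Summable f := by
    refine summable_of_sum_range_le (c := 1 / δ) hf fun n => ?_
    rw [le_div_iff₀ hδ, Finset.sum_mul]
    rcases n with _ | n
    · simp
    · refine le_trans ?_ (hup (n + 1))
      rw [hren]
      exact Finset.sum_le_sum fun j _ => mul_le_mul_of_nonneg_left (hlow _) (hf j)
  -- The partial sums tend to infinity with steps at most 1. By `hVren`, a total mass above 1 would
  -- force a step larger than 1 once V is large, and a mass below 1 would keep V bounded.
  set V : ℕ → ℝ := fun N => ∑ n ∈ Finset.range N, v n with hV
  have hV0 : ∀ N, 0 ≤ V N := fun N => Finset.sum_nonneg fun n _ => hv n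
  have hVmono : Monotone V := monotone_nat_of_le_succ fun N => by
    simp only [hV, Finset.sum_range_succ]; linarith [hv N]
  have hVsub : ∀ N j, V N - j ≤ V (N - j) := by
    intro N j
    induction j with
    | zero => simp
    | succ j ih =>
      rcases Nat.lt_or_ge j N with h | h
      · have : V (N - j) = V (N - (j + 1)) + v (N - (j + 1)) := by
          rw [show N - j = N - (j + 1) + 1 by omega]; simp only [hV, Finset.sum_range_succ]
        push_cast; linarith [hup (N - (j + 1))]
      · rw [show N - (j + 1) = N - j by omega]; push_cast; linarith
  have hVren : ∀ N, V (N + 1) = 1 + ∑ j ∈ Finset.range N, f j * V (N - j) := by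
    intro N
    induction N with
    | zero => simp [hV, hv0]
    | succ N ih =>
      have h1 : V (N + 1 + 1) = V (N + 1) + v (N + 1) := by
        simp only [hV, Finset.sum_range_succ _ (N + 1)]
      have h2 : ∑ j ∈ Finset.range (N + 1), f j * V (N + 1 - j) =
          ∑ j ∈ Finset.range (N + 1), f j * V (N - j) +
          ∑ j ∈ Finset.range (N + 1), f j * v (N - j) := by
        rw [← Finset.sum_add_distrib]
        refine Finset.sum_congr rfl fun j hj => ?_
        have := Finset.mem_range.1 hj
        rw [show N + 1 - j = N - j + 1 by omega, ← mul_add]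
        simp only [hV, Finset.sum_range_succ]
      have h3 : ∑ j ∈ Finset.range (N + 1), f j * V (N - j) =
          ∑ j ∈ Finset.range N, f j * V (N - j) := by
        rw [Finset.sum_range_succ]; simp [hV]
      rw [h1, h2, ih, hren, h3]; ring
  have hVtop : Tendsto V atTop atTop := by
    have : ∀ N : ℕ, (N : ℝ) * δ ≤ V N := by
      intro N
      calc (N : ℝ) * δ = ∑ _n ∈ Finset.range N, δ := by simp
        _ ≤ V N := Finset.sum_le_sum fun n _ => hlow n
    exact tendsto_atTop_mono this (tendsto_natCast_atTop_atTop.atTop_mul_const hδ)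
  have hle : ∑' j, f j ≤ 1 := by
    refine hsum.tsum_le_of_sum_range_le fun J => ?_
    by_contra! hJ
    set s := ∑ j ∈ Finset.range J, f j with hs
    obtain ⟨N, hN⟩ := ((hVtop.eventually_gt_atTop ((s * J) / (s - 1))).and
      (eventually_ge_atTop J)).exists
    have h1 : s * (V N - J) ≤ ∑ j ∈ Finset.range N, f j * V (N - j) := by
      rw [hs, Finset.sum_mul]
      refine le_trans (Finset.sum_le_sum fun j hj => ?_)
        (Finset.sum_le_sum_of_subset_of_nonneg (Finset.range_mono hN.2)
          fun j _ _ => mul_nonneg (hf j) (hV0 _))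
      refine mul_le_mul_of_nonneg_left (le_trans ?_ (hVsub N j)) (hf j)
      have : (j : ℝ) ≤ J := by exact_mod_cast (Finset.mem_range.1 hj).le
      linarith
    have h2 := hVren N
    have h3 : V (N + 1) = V N + v N := by simp only [hV, Finset.sum_range_succ]
    have h4 := (div_lt_iff₀ (sub_pos.2 hJ)).1 hN.1
    have h5 := hup N
    nlinarith
  have hge : 1 ≤ ∑' j, f j := by
    by_contra! hlt
    set s := ∑' j, f j with hs
    obtain ⟨N, hN⟩ := (hVtop.eventually_gt_atTop (1 / (1 - s))).exists
    have h1 : ∑ j ∈ Finset.range N, f j * V (N - j) ≤ s * V N := by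
      refine le_trans (Finset.sum_le_sum fun j _ =>
        mul_le_mul_of_nonneg_left (hVmono (Nat.sub_le N j)) (hf j)) ?_
      rw [← Finset.sum_mul]
      exact mul_le_mul_of_nonneg_right (hsum.sum_le_tsum _ fun j _ => hf j) (hV0 N)
    have h2 := hVren N
    have h3 := hVmono N.le_succ
    have h4 := (div_lt_iff₀ (sub_pos.2 hlt)).1 hN
    simp only [Nat.succ_eq_add_one] at h3
    nlinarith
  rw [← le_antisymm hle hge]
  exact hsum.hasSum

/-- The renewal theorem: an aperiodic renewal sequence that is bounded away from zero converges. -/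
theorem exists_tendsto_of_renewal {f v : ℕ → ℝ} {δ : ℝ} (hδ : 0 < δ) (hf : ∀ j, 0 ≤ f j)
    (hf0 : 0 < f 0) (hv0 : v 0 = 1)
    (hren : ∀ n, v (n + 1) = ∑ j ∈ Finset.range (n + 1), f j * v (n - j))
    (hlow : ∀ n, δ ≤ v n) (hup : ∀ n, v n ≤ 1) : ∃ c, δ ≤ c ∧ Tendsto v atTop (𝓝 c) := by
  have hs := hasSum_one_of_renewal hδ hf hv0 hren hlow hup
  -- The tails of f. Their sum is the mean waiting time, finite because v ≥ δ, and `hinv` is the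
  -- conserved quantity that determines the limit.
  set r : ℕ → ℝ := fun j => 1 - ∑ i ∈ Finset.range j, f i with hr
  have hr0 : ∀ j, 0 ≤ r j := fun j => sub_nonneg.2 (sum_le_hasSum _ (fun i _ => hf i) hs)
  have hinv : ∀ n, ∑ j ∈ Finset.range (n + 1), r j * v (n - j) = 1 := by
    intro n
    induction n with
    | zero => simp [hr, hv0]
    | succ n ih =>
      rw [Finset.sum_range_succ']
      have h1 : ∀ j, r (j + 1) = r j - f j := fun j => by
        simp only [hr, Finset.sum_range_succ]; ring
      simp only [h1, Nat.add_sub_add_right, sub_mul, Finset.sum_sub_distrib, ih, ← hren]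
      simp [hr]
  have hrs : Summable r := by
    refine summable_of_sum_range_le (c := 1 / δ) hr0 fun n => ?_
    rw [le_div_iff₀ hδ, Finset.sum_mul]
    rcases n with _ | n
    · simp
    · rw [← hinv n]
      exact Finset.sum_le_sum fun j _ => mul_le_mul_of_nonneg_left (hlow _) (hr0 j)
  have hR : 0 < ∑' j, r j := lt_of_lt_of_le (by simp [hr]) (hrs.le_tsum 0 fun j _ => hr0 j)
  have habs : ∀ n, |v n| ≤ 1 := fun n => abs_le.2 ⟨by linarith [hlow n], hup n⟩
  have h1 := limsup_eq_of_renewal hf hs hf0 hr0 hrs habs hren hinv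
  -- Applied to -v, the same lemma gives the lower limit; both limits are the reciprocal of the
  -- mean.
  have h2 := limsup_eq_of_renewal (a := fun n => -v n) (τ := -1) hf hs hf0 hr0 hrs (by simpa using habs)
    (by intro n; simp [hren]) (by intro n; simp [hinv])
  have hb1 : IsBoundedUnder (· ≤ ·) atTop v := isBoundedUnder_of ⟨1, hup⟩
  have hb2 : IsBoundedUnder (· ≤ ·) atTop (fun n => -v n) :=
    isBoundedUnder_of ⟨-δ, fun n => neg_le_neg (hlow n)⟩
  have e1 : limsup v atTop = 1 / ∑' j, r j := by field_simp; linarith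
  have e2 : limsup (fun n => -v n) atTop = -(1 / ∑' j, r j) := by
    field_simp; linarith
  have ht : Tendsto v atTop (𝓝 (1 / ∑' j, r j)) := by
    rw [tendsto_order]
    refine ⟨fun m hm => ?_, fun m hm => eventually_lt_of_limsup_lt (by rwa [e1]) hb1⟩
    filter_upwards [eventually_lt_of_limsup_lt (show limsup (fun n => -v n) atTop < -m by
      rw [e2]; linarith) hb2] with n hn
    linarith
  exact ⟨_, ge_of_tendsto' ht hlow, ht⟩

/-- Convolution of a convergent sequence that is bounded away from zero with a nonnegative
sequence, when the result is bounded. -/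
theorem exists_tendsto_convolution {v h w : ℕ → ℝ} {c δ K : ℝ} (hδ : 0 < δ) (hh : ∀ j, 0 ≤ h j)
    (hlow : ∀ n, δ ≤ v n) (hup : ∀ n, v n ≤ 1) (hv : Tendsto v atTop (𝓝 c))
    (hw : ∀ n, w (n + 1) = ∑ j ∈ Finset.range (n + 1), h j * v (n - j)) (hwK : ∀ n, w n ≤ K) :
    ∃ l, Tendsto w atTop (𝓝 l) := by
  have hsum : Summable h := by
    refine summable_of_sum_range_le (c := max K 0 / δ) hh fun n => ?_
    rw [le_div_iff₀ hδ, Finset.sum_mul]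
    rcases n with _ | n
    · simp
    · refine le_trans ?_ ((hwK (n + 1)).trans (le_max_left _ _))
      rw [hw]
      exact Finset.sum_le_sum fun j _ => mul_le_mul_of_nonneg_left (hlow _) (hh j)
  have habs : ∀ n, |v n| ≤ 1 := fun n => abs_le.2 ⟨by linarith [hlow n], hup n⟩
  have := tendsto_convolution le_rfl hh hsum habs (fun j => hv.comp (tendsto_sub_atTop_nat j))
  refine ⟨_, (tendsto_add_atTop_iff_nat 1).1 (this.congr fun n => (hw n).symm)⟩

/-- A sequence that is multiplicative up to a constant grows exactly exponentially. -/
theorem exists_growth {u : ℕ → ℝ} {C : ℝ} (hu : ∀ n, 1 ≤ u n) (hC : 0 < C)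
    (hsup : ∀ m n, u m * u n ≤ u (m + n)) (hsub : ∀ m n, u (m + n) ≤ C * (u m * u n)) :
    ∃ L : ℝ, 0 < L ∧ ∀ n, u n ≤ L ^ n ∧ L ^ n ≤ C * u n := by
  have hpos : ∀ n, 0 < u n := fun n => zero_lt_one.trans_le (hu n)
  -- Fekete's lemma twice: -log u and log (C u) are both subadditive, their limits are opposite, and
  -- each yields one of the two bounds.
  set p : ℕ → ℝ := fun n => -Real.log (u n) with hp
  set q : ℕ → ℝ := fun n => Real.log (C * u n) with hq
  have hqe : ∀ n, q n = Real.log C - p n := fun n => by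
    simp [hp, hq, Real.log_mul hC.ne' (hpos n).ne']
  have hps : Subadditive p := fun m n => by
    simp only [hp]
    have := Real.log_le_log (mul_pos (hpos m) (hpos n)) (hsup m n)
    rw [Real.log_mul (hpos m).ne' (hpos n).ne'] at this
    linarith
  have hqs : Subadditive q := fun m n => by
    simp only [hq]
    rw [← Real.log_mul (mul_pos hC (hpos m)).ne' (mul_pos hC (hpos n)).ne']
    exact Real.log_le_log (mul_pos hC (hpos _))
      ((mul_le_mul_of_nonneg_left (hsub m n) hC.le).trans_eq (by ring))
  have hqb : BddBelow (Set.range fun n => q n / n) := by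
    refine ⟨-|Real.log C|, ?_⟩
    rintro _ ⟨n, rfl⟩
    rcases Nat.eq_zero_or_pos n with rfl | hn
    · simp
    · have hn' : (1 : ℝ) ≤ n := by exact_mod_cast hn
      simp only
      rw [le_div_iff₀ (by linarith)]
      have h0 : p n ≤ 0 := by simpa [hp] using Real.log_nonneg (hu n)
      have h1 := neg_abs_le (Real.log C)
      have h2 := abs_nonneg (Real.log C)
      rw [hqe]; nlinarith
  have hqt := hqs.tendsto_lim hqb
  have hpt : Tendsto (fun n => p n / n) atTop (𝓝 (-hqs.lim)) := by
    have : Tendsto (fun n : ℕ => Real.log C / n - q n / n) atTop (𝓝 (0 - hqs.lim)) :=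
      (tendsto_const_div_atTop_nhds_zero_nat _).sub hqt
    rw [zero_sub] at this
    refine this.congr fun n => ?_
    rw [hqe]; ring
  have hpb : BddBelow (Set.range fun n => p n / n) := hpt.bddBelow_range
  have hplim : hps.lim = -hqs.lim := tendsto_nhds_unique (hps.tendsto_lim hpb) hpt
  refine ⟨Real.exp hqs.lim, Real.exp_pos _, fun n => ?_⟩
  rcases Nat.eq_zero_or_pos n with rfl | hn
  -- The bound from Fekete's lemma needs n ≠ 0. Here u 0 = 1 is forced, and then 1 ≤ C.
  · have h1 := hsup 0 0
    have h2 := hsub 0 0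
    have h3 := hpos 0
    simp only [add_zero] at h1 h2
    have : u 0 = 1 := le_antisymm (by nlinarith) (hu 0)
    rw [this] at h2 ⊢
    simpa using h2
  · have hn' : (0 : ℝ) < n := by exact_mod_cast hn
    have h1 := hps.lim_le_div hpb hn.ne'
    have h2 := hqs.lim_le_div hqb hn.ne'
    rw [hplim, le_div_iff₀ hn'] at h1
    rw [le_div_iff₀ hn'] at h2
    rw [← Real.exp_nat_mul]
    constructor
    · rw [← Real.log_le_iff_le_exp (hpos n)]
      simp only [hp] at h1; linarith
    · rw [← Real.le_log_iff_exp_le (mul_pos hC (hpos n))]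
      simp only [hq] at h2; linarith

/-! ### Counting pairs of binary words -/

noncomputable section

section Generic

variable {E : Type*} [CommRing E]

/-- The value of a pair of binary words. -/
def pairSum (b : E) (n : ℕ) (p : (Fin n → Fin 2) × (Fin n → Fin 2)) : E :=
  ∑ i : Fin n, (((p.1 i : ℕ) : E) - ((p.2 i : ℕ) : E)) * b ^ (n - 1 - (i : ℕ))

theorem codeSum_succ (b : E) {n : ℕ} (c : Fin (n + 1) → ℤ) :
    codeSum b c = b * codeSum b (fun i => c i.castSucc) + (c (Fin.last n) : E) := by
  unfold codeSum
  rw [Fin.sum_univ_castSucc, Finset.mul_sum]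
  congr 1
  · refine Finset.sum_congr rfl fun i _ => ?_
    have := i.2
    rw [Fin.val_castSucc, show n + 1 - 1 - (i : ℕ) = (n - 1 - i) + 1 by omega, pow_succ]
    ring
  · simp

theorem pairSum_eq_codeSum (b : E) (n : ℕ) (p : (Fin n → Fin 2) × (Fin n → Fin 2)) :
    pairSum b n p = codeSum b (fun i => ((p.1 i : ℕ) : ℤ) - ((p.2 i : ℕ) : ℤ)) := by
  simp [pairSum, codeSum]

/-- The differences of two binary letters are exactly the digits -1, 0, 1. -/
theorem count_pos_iff (b : E) (n : ℕ) (x : E) :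
    0 < count b n x ↔ ∃ c : Fin n → ℤ, (∀ i, c i ∈ digits) ∧ codeSum b c = x := by
  unfold count
  rw [Nat.card_pos_iff]
  constructor
  · rintro ⟨⟨⟨p, hp⟩⟩, -⟩
    refine ⟨_, fun i => ?_, (pairSum_eq_codeSum b n p).symm.trans hp⟩
    generalize p.1 i = s, p.2 i = t
    fin_cases s <;> fin_cases t <;> simp [digits]
  · rintro ⟨c, hc, rfl⟩
    refine ⟨⟨⟨(fun i => if c i = 1 then 1 else 0, fun i => if c i = -1 then 1 else 0), ?_⟩⟩,
      inferInstance⟩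
    refine Finset.sum_congr rfl fun i _ => ?_
    congr 1
    have h : c i = -1 ∨ c i = 0 ∨ c i = 1 := hc i
    rcases h with h | h | h <;> simp [h]

theorem mem_spectrumSet_iff (b : E) (x : E) :
    x ∈ spectrumSet digits b ↔ ∃ n, 0 < count b n x := by
  simp [spectrumSet, count_pos_iff]

theorem count_zero (b : E) (x : E) [Decidable (x = 0)] :
    count b 0 x = if x = 0 then 1 else 0 := by
  unfold count
  split_ifs with h
  · subst h
    simp
  · have : IsEmpty {p : (Fin 0 → Fin 2) × (Fin 0 → Fin 2) //
        ∑ i : Fin 0, (((p.1 i : ℕ) : E) - ((p.2 i : ℕ) : E)) * b ^ (0 - 1 - (i : ℕ)) = x} :=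
      ⟨fun p => h (by simpa using p.2.symm)⟩
    exact Nat.card_of_isEmpty

open Classical in
theorem count_eq_sum (b : E) (n : ℕ) (x : E) :
    (count b n x : ℝ) = ∑ p : (Fin n → Fin 2), ∑ q : (Fin n → Fin 2),
      if pairSum b n (p, q) = x then (1 : ℝ) else 0 := by
  have : count b n x = Nat.card {p // pairSum b n p = x} := rfl
  rw [this, Nat.card_eq_fintype_card, Fintype.card_subtype, ← Fintype.sum_prod_type']
  simp

theorem pairSum_snoc (b : E) (n : ℕ) (p q : Fin n → Fin 2) (s t : Fin 2) :
    pairSum b (n + 1) (Fin.snoc (α := fun _ => Fin 2) p s, Fin.snoc (α := fun _ => Fin 2) q t) =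
      b * pairSum b n (p, q) + (((s : ℕ) : E) - ((t : ℕ) : E)) := by
  rw [pairSum_eq_codeSum, codeSum_succ, pairSum_eq_codeSum]
  simp

theorem sum_fin_snoc {α M : Type*} [Fintype α] [AddCommMonoid M] (n : ℕ)
    (F : (Fin (n + 1) → α) → M) :
    ∑ p, F p = ∑ s : α, ∑ p : Fin n → α, F (Fin.snoc (α := fun _ => α) p s) := by
  rw [← Fintype.sum_prod_type', ← (Fin.snocEquiv fun _ : Fin (n + 1) => α).sum_comp]
  rfl

open Classical in
/-- By the Cauchy–Schwarz inequality, `0` has the most representations as a difference. -/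
theorem count_le_count_zero (b : E) (n : ℕ) (x : E) : count b n x ≤ count b n 0 := by
  set s : (Fin n → Fin 2) → E := fun p => ∑ i : Fin n, ((p i : ℕ) : E) * b ^ (n - 1 - (i : ℕ))
  have hs : ∀ p q, pairSum b n (p, q) = s p - s q := fun p q => by
    simp [pairSum, s, sub_mul, Finset.sum_sub_distrib]
  -- r y counts the words with value y, so `count b n x` is the correlation ∑ r y * r (y - x). Y
  -- contains all values and their translates by x, so that both sums of squares equal the count at
  -- 0.
  set r : E → ℝ := fun y => ∑ p, if s p = y then (1 : ℝ) else 0 with hr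
  set Y : Finset E := Finset.univ.image s ∪ Finset.univ.image (fun p => s p + x)
  have hY : ∀ p, s p ∈ Y := fun p => Finset.mem_union_left _ (Finset.mem_image_of_mem _ (by simp))
  have hY' : ∀ p, s p + x ∈ Y := fun p =>
    Finset.mem_union_right _ (Finset.mem_image_of_mem (fun p => s p + x) (by simp))
  have key : ∀ z w : E, (∀ p, s p + z ∈ Y) →
      ∑ y ∈ Y, r (y - z) * r (y - w) = (count b n (w - z) : ℝ) := by
    intro z w hz
    rw [count_eq_sum]
    simp only [hr, Finset.sum_mul_sum, hs]
    rw [Finset.sum_comm]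
    refine Finset.sum_congr rfl fun p _ => ?_
    rw [Finset.sum_comm]
    refine Finset.sum_congr rfl fun q _ => ?_
    rw [Finset.sum_eq_single_of_mem (s p + z) (hz p)]
    · simp only [add_sub_cancel_right, if_true, one_mul]
      congr 1
      exact propext ⟨fun h => by rw [h]; ring, fun h => by linear_combination -h⟩
    · intro y _ hy
      rw [if_neg (fun h => hy (by rw [h]; ring)), zero_mul]
  have h1 := key 0 x (by simpa using hY)
  have h2 := key 0 0 (by simpa using hY)
  have h3 := key x x hY'
  simp only [sub_zero, sub_self] at h1 h2 h3
  have h4 : (count b n x : ℝ) + count b n x ≤ count b n 0 + count b n 0 := by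
    nth_rewrite 1 [← h2]
    rw [← h3, ← h1, ← Finset.sum_add_distrib, ← Finset.sum_add_distrib]
    refine Finset.sum_le_sum fun y _ => ?_
    nlinarith [sq_nonneg (r y - r (y - x))]
  exact_mod_cast (by linarith : (count b n x : ℝ) ≤ count b n 0)

end Generic

variable {β : ℝ}

/-- The transfer operator of the maps `T_0` (with weight `2`) and `T_1`, `T_{-1}`. -/
def transfer (β : ℝ) (f : ℝ → ℝ) (x : ℝ) : ℝ :=
  2 * f (x / β) + f ((x - 1) / β) + f ((x + 1) / β)

/-- Sort the pairs by their last letters, whose difference is 0 in two ways and 1 or -1 in one way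
each, and undo the last map by dividing by β. -/
theorem count_succ (hβ : β ≠ 0) (n : ℕ) (x : ℝ) :
    (count β (n + 1) x : ℝ) = transfer β (fun y => count β n y) x := by
  classical
  have key : ∀ (s t : Fin 2) (p q : Fin n → Fin 2),
      β * pairSum β n (p, q) + (((s : ℕ) : ℝ) - ((t : ℕ) : ℝ)) = x ↔
      pairSum β n (p, q) = (x - (((s : ℕ) : ℝ) - ((t : ℕ) : ℝ))) / β := by
    intro s t p q
    rw [eq_div_iff hβ, mul_comm]
    constructor <;> intro h <;> linarith
  unfold transfer
  rw [count_eq_sum, sum_fin_snoc]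
  have : ∀ s : Fin 2, ∑ p : Fin n → Fin 2, ∑ q : Fin (n + 1) → Fin 2,
      (if pairSum β (n + 1) (Fin.snoc (α := fun _ => Fin 2) p s, q) = x then (1 : ℝ) else 0) =
      ∑ t : Fin 2, (count β n ((x - (((s : ℕ) : ℝ) - ((t : ℕ) : ℝ))) / β) : ℝ) := by
    intro s
    simp_rw [count_eq_sum, sum_fin_snoc, pairSum_snoc, key]
    rw [Finset.sum_comm]
  simp_rw [this, Fin.sum_univ_two]
  simp
  ring

/-- Splitting a code of length `m + n` into its first `m` and its last `n` letters. -/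
theorem count_add (hβ : β ≠ 0) (m n : ℕ) (x : ℝ) (Y : Finset ℝ)
    (hY : ∀ y, count β m y * count β n (x - β ^ n * y) ≠ 0 → y ∈ Y) :
    (count β (m + n) x : ℝ) = ∑ y ∈ Y, (count β m y : ℝ) * count β n (x - β ^ n * y) := by
  classical
  -- Only the support of the summand matters, so the induction is run with Y the set of all values
  -- of pairs of words of length m.
  have full : ∀ n x, (count β (m + n) x : ℝ) =
      ∑ y ∈ Finset.univ.image (pairSum β m), (count β m y : ℝ) * count β n (x - β ^ n * y) := by
    have hsupp : ∀ y, y ∉ Finset.univ.image (pairSum β m) → count β m y = 0 := by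
      intro y hy
      by_contra h
      obtain ⟨⟨p, hp⟩⟩ := (Nat.card_pos_iff.1 (Nat.pos_of_ne_zero h)).1
      exact hy (Finset.mem_image.2 ⟨p, Finset.mem_univ _, hp⟩)
    intro n
    induction n with
    | zero =>
      intro x
      rw [Finset.sum_eq_single x]
      · simp [count_zero]
      · intro y _ hy
        simp [count_zero, sub_eq_zero, Ne.symm hy]
      · intro hx
        simp [hsupp x hx]
    | succ n ih =>
      intro x
      rw [← add_assoc, count_succ hβ]
      simp only [transfer, ih, count_succ hβ, Finset.mul_sum, ← Finset.sum_add_distrib]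
      refine Finset.sum_congr rfl fun y _ => ?_
      have e : ∀ c : ℝ, (x + c) / β - β ^ n * y = (x - β ^ (n + 1) * y + c) / β := fun c => by
        field_simp; ring
      have e0 := e 0
      have e1 := e (-1)
      simp only [add_zero, ← sub_eq_add_neg] at e0 e1
      rw [e0, e1, e 1]
      ring
  rw [full]
  have hz : ∀ y, (count β m y : ℝ) * count β n (x - β ^ n * y) ≠ 0 → y ∈ Y := fun y h =>
    hY y (by exact_mod_cast h)
  calc _ = ∑ y ∈ Finset.univ.image (pairSum β m) ∪ Y,
        (count β m y : ℝ) * count β n (x - β ^ n * y) := by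
        refine Finset.sum_subset Finset.subset_union_left fun y _ hy => ?_
        have : ¬ 0 < count β m y := fun h => by
          obtain ⟨⟨p, hp⟩⟩ := (Nat.card_pos_iff.1 h).1
          exact hy (Finset.mem_image.2 ⟨p, Finset.mem_univ _, hp⟩)
        simp [Nat.eq_zero_of_not_pos this]
    _ = _ := by
        refine (Finset.sum_subset Finset.subset_union_right fun y _ hy => ?_).symm
        exact not_not.1 fun h => hy (hz y h)

/-- A single term of `count_add`: the paths that pass through y at time m. -/
theorem mul_count_le (hβ : β ≠ 0) (m n : ℕ) (x y : ℝ) :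
    (count β m y : ℝ) * count β n (x - β ^ n * y) ≤ count β (m + n) x := by
  classical
  rw [count_add hβ m n x (insert y (Finset.univ.image (pairSum β m)))]
  · exact Finset.single_le_sum (f := fun y => (count β m y : ℝ) * count β n (x - β ^ n * y))
      (fun _ _ => by positivity) (Finset.mem_insert_self _ _)
  · intro z hz
    obtain ⟨⟨p, hp⟩⟩ := (Nat.card_pos_iff.1 (Nat.pos_of_ne_zero (left_ne_zero_of_mul hz))).1
    exact Finset.mem_insert_of_mem (Finset.mem_image.2 ⟨p, Finset.mem_univ _, hp⟩)

/-! ### Loops at 0, growth rate and limit masses -/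

/-- The points that lie on a path from `0` to `0`. -/
def returnSet (β : ℝ) : Set ℝ :=
  {x | ∃ m n, 0 < count β m x ∧ 0 < count β n (-(β ^ n * x))}

theorem one_le_count_zero (n : ℕ) : 1 ≤ count β n 0 :=
  (count_pos_iff β n 0).2 ⟨fun _ => 0, by simp [digits], by simp [codeSum]⟩

/-- A loop of length m + n is at a point of `returnSet` at time m, and each such point contributes
at most the product of the two counts at 0. This gives submultiplicativity up to the number of
points; adding 1 makes the constant visibly positive. -/
theorem exists_count_growth (hβ : β ≠ 0) (hfin : (returnSet β).Finite) :
    ∃ L C : ℝ, 0 < L ∧ 0 < C ∧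
      ∀ n, (count β n 0 : ℝ) ≤ L ^ n ∧ L ^ n ≤ C * (count β n 0 : ℝ) := by
  have hu : ∀ n, (1 : ℝ) ≤ count β n 0 := fun n => by exact_mod_cast one_le_count_zero n
  have hsup : ∀ m n, (count β m 0 : ℝ) * count β n 0 ≤ count β (m + n) 0 := fun m n => by
    simpa using mul_count_le hβ m n 0 0
  have hsub : ∀ m n, (count β (m + n) 0 : ℝ) ≤
      (hfin.toFinset.card + 1) * (count β m 0 * count β n 0) := by
    intro m n
    rw [count_add hβ m n 0 hfin.toFinset]
    · calc _ ≤ ∑ _y ∈ hfin.toFinset, (count β m 0 : ℝ) * count β n 0 := by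
            refine Finset.sum_le_sum fun y _ => ?_
            gcongr <;> exact count_le_count_zero _ _ _
        _ ≤ _ := by
            rw [Finset.sum_const, nsmul_eq_mul]
            gcongr
            linarith
    · intro y hy
      rw [Set.Finite.mem_toFinset]
      refine ⟨m, n, Nat.pos_of_ne_zero (left_ne_zero_of_mul hy), Nat.pos_of_ne_zero ?_⟩
      simpa using right_ne_zero_of_mul hy
  obtain ⟨L, hL, h⟩ := exists_growth hu (by positivity) hsup hsub
  exact ⟨L, _, hL, by positivity, h⟩

open Classical in
/-- The number of weighted paths of length `j + 1` from `0` to `x` that leave `0` for good. -/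
def tabooCount (β : ℝ) : ℕ → ℝ → ℝ
  | 0 => transfer β fun y => if y = 0 then 1 else 0
  | j + 1 => transfer β fun y => if y = 0 then 0 else tabooCount β j y

theorem tabooCount_nonneg (j : ℕ) (x : ℝ) : 0 ≤ tabooCount β j x := by
  induction j generalizing x with
  | zero =>
    simp only [tabooCount, transfer]
    have h : ∀ y : ℝ, (0 : ℝ) ≤ if y = 0 then 1 else 0 := fun y => by split_ifs <;> norm_num
    have := h (x / β); have := h ((x - 1) / β); have := h ((x + 1) / β)
    linarith
  | succ j ih =>
    simp only [tabooCount, transfer]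
    have h : ∀ y : ℝ, (0 : ℝ) ≤ if y = 0 then 0 else tabooCount β j y := fun y => by
      split_ifs
      · exact le_rfl
      · exact ih y
    have := h (x / β); have := h ((x - 1) / β); have := h ((x + 1) / β)
    linarith

/-- Decomposition of the paths according to their last visit of `0`. -/
theorem count_succ_eq_sum_tabooCount (hβ : β ≠ 0) (n : ℕ) (x : ℝ) :
    (count β (n + 1) x : ℝ) =
      ∑ j ∈ Finset.range (n + 1), tabooCount β j x * count β (n - j) 0 := by
  induction n generalizing x with
  | zero =>
    rw [count_succ hβ]
    simp [tabooCount, transfer, count_zero]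
  | succ n ih =>
    have hdec : ∀ y, (count β (n + 1) y : ℝ) = (if y = 0 then 1 else 0) * count β (n + 1) 0 +
        ∑ j ∈ Finset.range (n + 1), (if y = 0 then 0 else tabooCount β j y) * count β (n - j) 0 := by
      intro y
      by_cases hy : y = 0
      · simp [hy]
      · simp [hy, ih y]
    rw [count_succ hβ, Finset.sum_range_succ']
    simp only [tabooCount, transfer, Nat.add_sub_add_right, Nat.sub_zero]
    rw [hdec (x / β), hdec ((x - 1) / β), hdec ((x + 1) / β)]
    simp only [add_mul, Finset.sum_add_distrib, mul_add, Finset.mul_sum, mul_assoc]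
    ring

/-- The normalized counts converge. -/
theorem exists_tendsto_count {L C : ℝ} (hβ : β ≠ 0) (hL : 0 < L) (hC : 0 < C)
    (hLC : ∀ n, (count β n 0 : ℝ) ≤ L ^ n ∧ L ^ n ≤ C * (count β n 0 : ℝ)) (x : ℝ) :
    ∃ l, Tendsto (fun n => (count β n x : ℝ) / L ^ n) atTop (𝓝 l) := by
  have hδ : 0 < 1 / C := by positivity
  have hlow : ∀ n, 1 / C ≤ (count β n 0 : ℝ) / L ^ n := fun n => by
    rw [div_le_div_iff₀ hC (pow_pos hL n)]
    linarith [(hLC n).2]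
  have hup : ∀ n (y : ℝ), (count β n y : ℝ) / L ^ n ≤ 1 := fun n y => by
    rw [div_le_one (pow_pos hL n)]
    refine le_trans ?_ (hLC n).1
    exact_mod_cast count_le_count_zero β n y
  have hdec : ∀ (y : ℝ) (n : ℕ), (count β (n + 1) y : ℝ) / L ^ (n + 1) =
      ∑ j ∈ Finset.range (n + 1), tabooCount β j y / L ^ (j + 1) *
        ((count β (n - j) 0 : ℝ) / L ^ (n - j)) := by
    intro y n
    rw [count_succ_eq_sum_tabooCount hβ, Finset.sum_div]
    refine Finset.sum_congr rfl fun j hj => ?_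
    have := Finset.mem_range.1 hj
    rw [div_mul_div_comm, ← pow_add, show j + 1 + (n - j) = n + 1 by omega]
  have hnn : ∀ (y : ℝ) (j : ℕ), 0 ≤ tabooCount β j y / L ^ (j + 1) := fun y j =>
    div_nonneg (tabooCount_nonneg j y) (pow_pos hL _).le
  -- T_0 fixes 0, a loop of length one: this is the aperiodicity.
  have hf0 : 0 < tabooCount β 0 0 / L ^ (0 + 1) := by
    refine div_pos ?_ (pow_pos hL _)
    simp only [tabooCount, transfer, zero_div, if_true]
    split_ifs <;> norm_num
  obtain ⟨c, -, hc⟩ := exists_tendsto_of_renewal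
    (v := fun n => (count β n 0 : ℝ) / L ^ n) hδ (hnn 0) hf0 (by simp [count_zero])
    (hdec 0) hlow (fun n => hup n 0)
  exact exists_tendsto_convolution hδ (hnn x) hlow (fun n => hup n 0) hc (hdec x) (fun n => hup n x)

/-- The limit of the normalized counts is positive on the spectrum. -/
theorem limit_pos {L C : ℝ} (hβ : β ≠ 0) (hL : 0 < L) (hC : 0 < C)
    (hLC : ∀ n, (count β n 0 : ℝ) ≤ L ^ n ∧ L ^ n ≤ C * (count β n 0 : ℝ)) {x l : ℝ}
    (hx : x ∈ spectrumSet digits β)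
    (hl : Tendsto (fun n => (count β n x : ℝ) / L ^ n) atTop (𝓝 l)) : 0 < l := by
  obtain ⟨k, hk⟩ := (mem_spectrumSet_iff β x).1 hx
  -- From any of the loops of length n at 0 one may go on along a fixed path of length k to x, so
  -- the count at time n + k is at least L ^ n / C.
  refine lt_of_lt_of_le (show 0 < 1 / (C * L ^ k) by positivity) ?_
  refine ge_of_tendsto ((tendsto_add_atTop_iff_nat k).2 hl) (Eventually.of_forall fun n => ?_)
  have h1 : (count β n 0 : ℝ) * count β k x ≤ count β (n + k) x := by
    simpa using mul_count_le hβ n k x 0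
  have h2 : (1 : ℝ) ≤ count β k x := by exact_mod_cast hk
  have h3 : (0 : ℝ) ≤ count β n 0 := by positivity
  rw [div_le_div_iff₀ (by positivity) (pow_pos hL _), pow_add]
  have h4 := (hLC n).2
  have h5 : L ^ n ≤ C * count β (n + k) x := h4.trans (mul_le_mul_of_nonneg_left (by nlinarith) hC.le)
  have := mul_le_mul_of_nonneg_right h5 (pow_pos hL k).le
  linarith

theorem limit_eq_zero {L x l : ℝ} (hx : x ∉ spectrumSet digits β)
    (hl : Tendsto (fun n => (count β n x : ℝ) / L ^ n) atTop (𝓝 l)) : l = 0 := by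
  refine tendsto_nhds_unique hl (tendsto_const_nhds.congr fun n => ?_)
  have : count β n x = 0 := by
    by_contra h
    exact hx ((mem_spectrumSet_iff β x).2 ⟨n, Nat.pos_of_ne_zero h⟩)
  simp [this]

/-- The limit mass is an eigenfunction of the transfer operator. -/
theorem transfer_limit {L : ℝ} (hβ : β ≠ 0) (hL : 0 < L) {ν : ℝ → ℝ}
    (hν : ∀ x, Tendsto (fun n => (count β n x : ℝ) / L ^ n) atTop (𝓝 (ν x))) (x : ℝ) :
    transfer β ν x = L * ν x := by
  have h1 : Tendsto (fun n => L * ((count β (n + 1) x : ℝ) / L ^ (n + 1))) atTop (𝓝 (L * ν x)) :=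
    ((tendsto_add_atTop_iff_nat 1).2 (hν x)).const_mul L
  have h2 : Tendsto (fun n => transfer β (fun y => (count β n y : ℝ) / L ^ n) x) atTop
      (𝓝 (transfer β ν x)) :=
    (((hν _).const_mul 2).add (hν _)).add (hν _)
  refine tendsto_nhds_unique h2 (h1.congr fun n => ?_)
  rw [count_succ hβ, pow_succ]
  simp only [transfer]
  field_simp

end

/-! ### Spectral radius from a left eigenvector and a bound on powers -/

section Radius

variable {ι : Type*} [Fintype ι]

open Classical in
theorem mem_spectrum_iff_det (A : Matrix ι ι ℂ) (κ : ℂ) :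
    κ ∈ spectrum ℂ A ↔ (κ • (1 : Matrix ι ι ℂ) - A).det = 0 := by
  rw [spectrum.mem_iff, Matrix.isUnit_iff_isUnit_det, Algebra.algebraMap_eq_smul_one,
    isUnit_iff_ne_zero, not_not]

open Classical in
/-- The spectral radius of a matrix whose powers grow at most like `L ^ n` and which has `L` as an
eigenvalue. -/
theorem matRadius_eq {L : ℝ} (hL : 0 < L) (A : Matrix ι ι ℝ) (w : ι → ℝ) (hw : w ≠ 0)
    (hwA : Matrix.vecMul w A = L • w)
    (hg : ∀ n m l, |(A ^ n) m l| ≤ L ^ n) : matRadius A = L := by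
  have hup : spectralRadius ℂ (A.map fun r : ℝ => (r : ℂ)) ≤ ENNReal.ofReal L := by
    refine iSup₂_le fun κ hκ => ?_
    rw [mem_spectrum_iff_det] at hκ
    obtain ⟨u, hu, hAu⟩ := Matrix.exists_mulVec_eq_zero_iff.2 hκ
    have hAu' : Matrix.mulVec (A.map fun r : ℝ => (r : ℂ)) u = κ • u := by
      rw [Matrix.sub_mulVec, Matrix.smul_mulVec, Matrix.one_mulVec, sub_eq_zero] at hAu
      exact hAu.symm
    obtain ⟨m, hm⟩ := Function.ne_iff.1 hu
    have hm' : 0 < ‖u m‖ := norm_pos_iff.2 hm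
    set K := (∑ l, ‖u l‖) / ‖u m‖
    have hpow : ∀ n : ℕ, Matrix.mulVec ((A ^ n).map fun r : ℝ => (r : ℂ)) u = κ ^ n • u := by
      intro n
      induction n with
      | zero => simp [Matrix.map_one]
      | succ n ih =>
        have : (A ^ (n + 1)).map (fun r : ℝ => (r : ℂ)) =
            (A ^ n).map (fun r : ℝ => (r : ℂ)) * A.map (fun r : ℝ => (r : ℂ)) := by
          rw [pow_succ]
          exact Matrix.map_mul (f := Complex.ofRealHom)
        rw [this, ← Matrix.mulVec_mulVec, hAu', Matrix.mulVec_smul, ih, smul_smul, pow_succ']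
    -- Coordinate m of A ^ n u = κ ^ n u; the constant K does not depend on n, so |κ| > L is
    -- impossible.
    have hbound : ∀ n : ℕ, ‖κ‖ ^ n ≤ L ^ n * K := by
      intro n
      have h1 := congrFun (hpow n) m
      simp only [Matrix.mulVec, dotProduct, Matrix.map_apply, Pi.smul_apply, smul_eq_mul] at h1
      have h2 : ‖κ‖ ^ n * ‖u m‖ ≤ L ^ n * ∑ l, ‖u l‖ := by
        rw [← norm_pow, ← norm_mul, ← h1, Finset.mul_sum]
        refine (norm_sum_le _ _).trans (Finset.sum_le_sum fun l _ => ?_)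
        rw [norm_mul, Complex.norm_real]
        exact mul_le_mul_of_nonneg_right (hg n m l) (norm_nonneg _)
      rw [← mul_div_assoc, le_div_iff₀ hm']
      exact h2
    have hle : ‖κ‖ ≤ L := by
      by_contra! h
      have h1 : 1 < ‖κ‖ / L := (one_lt_div hL).2 h
      obtain ⟨n, hn⟩ := pow_unbounded_of_one_lt K h1
      rw [div_pow, lt_div_iff₀ (pow_pos hL n)] at hn
      linarith [hbound n]
    rw [← ENNReal.ofReal_coe_nnreal]
    exact ENNReal.ofReal_le_ofReal hle
  have hlow : ENNReal.ofReal L ≤ spectralRadius ℂ (A.map fun r : ℝ => (r : ℂ)) := by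
    have hmem : (L : ℂ) ∈ spectrum ℂ (A.map fun r : ℝ => (r : ℂ)) := by
      rw [mem_spectrum_iff_det]
      refine Matrix.exists_vecMul_eq_zero_iff.1 ⟨fun i => (w i : ℂ), ?_, ?_⟩
      · obtain ⟨m, hm⟩ := Function.ne_iff.1 hw
        exact Function.ne_iff.2 ⟨m, by simpa using hm⟩
      · rw [Matrix.vecMul_sub, Matrix.vecMul_smul, Matrix.vecMul_one, sub_eq_zero]
        funext l
        have := congrFun hwA l
        simp only [Matrix.vecMul, dotProduct, Matrix.map_apply, Pi.smul_apply, smul_eq_mul] at this ⊢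
        exact_mod_cast this.symm
    refine le_trans (le_of_eq ?_) (le_iSup₂ (f := fun k _ => (‖k‖₊ : ENNReal)) (L : ℂ) hmem)
    rw [ENNReal.ofReal, ENNReal.coe_inj]
    ext
    simp [hL.le, abs_of_pos hL]
  have := le_antisymm hup hlow
  unfold matRadius
  rw [← ENNReal.toReal_ofReal hL.le, ← this]

end Radius

/-! ### Transition matrices as restrictions of the transfer operator -/

variable {β : ℝ} {ι : Type*} [Fintype ι] {d : ι → ℝ}

-- The three preimages of d l + i are distinct, so at most one case of the definition applies and
-- the entry is a sum of indicators carrying the weights of `transfer`.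
open Classical in
theorem transMatrix_apply {κ : Type*} (hβ : β ≠ 0) (d : κ → ℝ) (i : ℤ) (m l : κ) :
    transMatrix β d i m l = (if d m = (d l + i) / β then 2 else 0) +
      (if d m = (d l + i - 1) / β then 1 else 0) + (if d m = (d l + i + 1) / β then 1 else 0) := by
  have e0 : T β (-i) (d m) = d l ↔ d m = (d l + i) / β := by
    rw [eq_div_iff hβ, T]; push_cast
    constructor <;> intro h <;> linarith
  have e1 : T β (1 - i) (d m) = d l ↔ d m = (d l + i - 1) / β := by
    rw [eq_div_iff hβ, T]; push_cast
    constructor <;> intro h <;> linarith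
  have e2 : T β (-1 - i) (d m) = d l ↔ d m = (d l + i + 1) / β := by
    rw [eq_div_iff hβ, T]; push_cast
    constructor <;> intro h <;> linarith
  simp only [transMatrix, Matrix.of_apply, e0, e1, e2]
  have inj : ∀ a b : ℝ, a / β = b / β → a = b := fun a b h => (div_left_inj' hβ).1 h
  by_cases h0 : d m = (d l + i) / β
  · have h1 : ¬ d m = (d l + i - 1) / β := fun h => by linarith [inj _ _ (h0.symm.trans h)]
    have h2 : ¬ d m = (d l + i + 1) / β := fun h => by linarith [inj _ _ (h0.symm.trans h)]
    rw [if_neg (by simp [h1, h2]), if_pos h0, if_neg h1, if_neg h2]; norm_num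
  · by_cases h1 : d m = (d l + i - 1) / β
    · have h2 : ¬ d m = (d l + i + 1) / β := fun h => by linarith [inj _ _ (h1.symm.trans h)]
      rw [if_pos (Or.inl h1), if_neg h0, if_pos h1, if_neg h2]; norm_num
    · by_cases h2 : d m = (d l + i + 1) / β
      · rw [if_pos (Or.inr h2), if_neg h0, if_neg h1, if_pos h2]; norm_num
      · simp [h0, h1, h2]

open Classical in
theorem sum_mul_ite_le (hd : Function.Injective d) {w : ℝ → ℝ} (hw : ∀ y, 0 ≤ w y) {c : ℝ}
    (hc : 0 ≤ c) (x : ℝ) : ∑ m, w (d m) * (if d m = x then c else 0) ≤ c * w x := by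
  by_cases hx : ∃ m, d m = x
  · obtain ⟨m, rfl⟩ := hx
    rw [Finset.sum_eq_single m]
    · simp [mul_comm]
    · intro k _ hk
      simp [hd.ne hk]
    · simp
  · push Not at hx
    rw [Finset.sum_eq_zero fun m _ => by simp [hx m]]
    exact mul_nonneg hc (hw x)

open Classical in
theorem sum_mul_ite_eq (hd : Function.Injective d) {w : ℝ → ℝ} (c x : ℝ)
    (hx : w x ≠ 0 → x ∈ Set.range d) : ∑ m, w (d m) * (if d m = x then c else 0) = c * w x := by
  by_cases hx' : ∃ m, d m = x
  · obtain ⟨m, rfl⟩ := hx'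
    rw [Finset.sum_eq_single m]
    · simp [mul_comm]
    · intro k _ hk
      simp [hd.ne hk]
    · simp
  · have : w x = 0 := not_not.1 fun h => hx' (hx h)
    push Not at hx'
    rw [Finset.sum_eq_zero fun m _ => by simp [hx' m], this, mul_zero]

/-- Preimages outside the finite set are lost, which can only decrease the sum of nonnegative terms.
-/
theorem vecMul_transMatrix_le (hβ : β ≠ 0) (hd : Function.Injective d) {w : ℝ → ℝ}
    (hw : ∀ y, 0 ≤ w y) (i : ℤ) (l : ι) :
    Matrix.vecMul (fun m => w (d m)) (transMatrix β d i) l ≤ transfer β w (d l + i) := by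
  classical
  simp only [Matrix.vecMul, dotProduct, transMatrix_apply hβ, mul_add, Finset.sum_add_distrib,
    transfer]
  have h0 := sum_mul_ite_le hd hw (c := 2) (by norm_num) ((d l + i) / β)
  have h1 := sum_mul_ite_le hd hw (c := 1) (by norm_num) ((d l + i - 1) / β)
  have h2 := sum_mul_ite_le hd hw (c := 1) (by norm_num) ((d l + i + 1) / β)
  rw [one_mul] at h1 h2
  exact add_le_add (add_le_add h0 h1) h2

/-- Nothing is lost when every preimage with nonzero weight is among the points d m. Asking this
only where w is nonzero is what lets finite sets qualify. -/
theorem vecMul_transMatrix_eq (hβ : β ≠ 0) (hd : Function.Injective d) {w : ℝ → ℝ} (i : ℤ) (l : ι)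
    (hw : ∀ x, ∀ j ∈ digits, β * x + j - i = d l → w x ≠ 0 → x ∈ Set.range d) :
    Matrix.vecMul (fun m => w (d m)) (transMatrix β d i) l = transfer β w (d l + i) := by
  classical
  simp only [Matrix.vecMul, dotProduct, transMatrix_apply hβ, mul_add, Finset.sum_add_distrib,
    transfer]
  rw [sum_mul_ite_eq hd, sum_mul_ite_eq hd, sum_mul_ite_eq hd, one_mul, one_mul]
  · refine hw _ (-1) (by simp [digits]) ?_
    rw [mul_div_cancel₀ _ hβ]; push_cast; ring
  · refine hw _ 1 (by simp [digits]) ?_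
    rw [mul_div_cancel₀ _ hβ]; push_cast; ring
  · refine hw _ 0 (by simp [digits]) ?_
    rw [mul_div_cancel₀ _ hβ]; push_cast; ring

/-- The product formula for an eigenfunction of the transfer operator that is supported by the
spectrum. -/
theorem vecMul_prod (hβ : β ≠ 0) (hd : Function.Injective d) {L : ℝ} {ν : ℝ → ℝ}
    (hν : ∀ x, transfer β ν x = L * ν x) (hν0 : ∀ x, x ∉ spectrumSet digits β → ν x = 0)
    (hcl : ∀ t ∈ spectrumSet digits β, ∀ x, t + x ∈ spectrumSet digits β → ∀ i ∈ digits,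
      ∀ j ∈ digits, ∀ l, β * x + j - i = d l → x ∈ Set.range d)
    [DecidableEq ι] {A : ℤ → Matrix ι ι ℝ} (hA : ∀ i ∈ digits, A i = transMatrix β d i)
    {n : ℕ} (c : Fin n → ℤ) (hc : ∀ i, c i ∈ digits) (l : ι) :
    Matrix.vecMul (fun m => ν (d m)) (List.ofFn fun i => A (c i)).prod l =
      L ^ n * ν (codeSum β c + d l) := by
  induction n generalizing l with
  | zero => simp [codeSum]
  | succ n ih =>
    have ht : codeSum β (fun i : Fin n => c i.castSucc) ∈ spectrumSet digits β :=
      ⟨n, _, fun i => hc _, rfl⟩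
    rw [List.ofFn_succ', List.prod_concat, ← Matrix.vecMul_vecMul, hA _ (hc _)]
    have := funext fun l => ih (fun i => c i.castSucc) (fun i => hc _) l
    rw [this]
    -- With t the value of the first n letters, the current row vector samples the translate y ↦ L ^
    -- n * ν (t + y). Its transfer at d l + c is the transfer of ν at βt + c + d l, where ν is an
    -- eigenfunction.
    rw [vecMul_transMatrix_eq hβ hd (w := fun y =>
      L ^ n * ν (codeSum β (fun i : Fin n => c i.castSucc) + y))]
    · have h := hν (codeSum β c + d l)
      rw [pow_succ, mul_assoc, ← h, codeSum_succ]
      simp only [transfer]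
      have e : ∀ s : ℝ, codeSum β (fun i : Fin n => c i.castSucc) +
          (d l + (c (Fin.last n) : ℝ) + s) / β =
          (β * codeSum β (fun i : Fin n => c i.castSucc) + (c (Fin.last n) : ℝ) + d l + s) / β := by
        intro s
        field_simp; ring
      have e0 := e 0
      have e1 := e (-1)
      simp only [add_zero, ← sub_eq_add_neg] at e0 e1
      rw [e0, e1, e 1]
      ring
    · intro x j hj hx hne
      refine hcl _ ht x ?_ _ (hc _) j hj l hx
      by_contra h
      exact hne (by rw [hν0 _ h, mul_zero])

/-- The spectral radius of the transition matrix on a finite set that contains `0` and the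
preimages of its points. -/
theorem matRadius_transMatrix {L : ℝ} {ν : ℝ → ℝ} (hβ : β ≠ 0) (hL : 0 < L)
    (hcount : ∀ n, (count β n 0 : ℝ) ≤ L ^ n)
    (hν : ∀ x, transfer β ν x = L * ν x) (hν0 : ∀ x, x ∉ spectrumSet digits β → ν x = 0)
    (hνpos : 0 < ν 0) (hd : Function.Injective d) (hd0 : (0 : ℝ) ∈ Set.range d)
    (hcl : ∀ x ∈ spectrumSet digits β, ∀ j ∈ digits, ∀ l, β * x + j = d l → x ∈ Set.range d) :
    matRadius (transMatrix β d 0) = L := by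
  classical
  obtain ⟨o, ho⟩ := hd0
  have hnn : ∀ m l, 0 ≤ transMatrix β d 0 m l := fun m l => by
    simp only [transMatrix, Matrix.of_apply]
    split_ifs <;> norm_num
  -- Entries of the n-th power count paths from d m to d l inside the finite set, so they are at
  -- most an unrestricted count, itself bounded by the count at 0.
  have hpow : ∀ n m l, 0 ≤ (transMatrix β d 0 ^ n) m l ∧
      (transMatrix β d 0 ^ n) m l ≤ count β n (d l - β ^ n * d m) := by
    intro n
    induction n with
    | zero =>
      intro m l
      rw [pow_zero, Matrix.one_apply]
      split_ifs with h
      · simp [h, count_zero]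
      · simp
    | succ n ih =>
      intro m l
      have e : (transMatrix β d 0 ^ (n + 1)) m l =
          ∑ k, (transMatrix β d 0 ^ n) m k * transMatrix β d 0 k l := by
        rw [pow_succ, Matrix.mul_apply]
      rw [e]
      refine ⟨Finset.sum_nonneg fun k _ => mul_nonneg (ih m k).1 (hnn k l), ?_⟩
      refine (Finset.sum_le_sum fun k _ =>
        mul_le_mul_of_nonneg_right (ih m k).2 (hnn k l)).trans ?_
      refine (vecMul_transMatrix_le hβ hd (w := fun y => (count β n (y - β ^ n * d m) : ℝ))
        (fun y => Nat.cast_nonneg _) 0 l).trans (le_of_eq ?_)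
      rw [count_succ hβ]
      simp only [transfer, Int.cast_zero, add_zero]
      have e : ∀ s : ℝ, (d l + s) / β - β ^ n * d m = (d l - β ^ (n + 1) * d m + s) / β := by
        intro s
        field_simp; ring
      have e0 := e 0
      have e1 := e (-1)
      simp only [add_zero, ← sub_eq_add_neg] at e0 e1
      rw [e0, e1, e 1]
  refine matRadius_eq hL _ (fun m => ν (d m)) ?_ ?_ fun n m l => ?_
  · exact Function.ne_iff.2 ⟨o, by simpa [ho] using hνpos.ne'⟩
  · funext l
    rw [vecMul_transMatrix_eq hβ hd, Int.cast_zero, add_zero, hν]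
    · rfl
    · intro x j hj hx hne
      refine hcl x (not_not.1 fun h => hne (hν0 x h)) j hj l ?_
      simpa using hx
  · rw [abs_of_nonneg (hpow n m l).1]
    refine (hpow n m l).2.trans (le_trans ?_ (hcount n))
    exact_mod_cast count_le_count_zero β n _

/-! ### The space 𝕂, the lattice ℤ[β] and bounds at the conjugates -/

noncomputable section

theorem map_codeSum {E F : Type*} [CommRing E] [CommRing F] (f : E →+* F) (b : E) {n : ℕ}
    (c : Fin n → ℤ) : f (codeSum b c) = codeSum (f b) c := by
  simp [codeSum]

theorem iterT_eq {E : Type*} [CommRing E] (b : E) {n : ℕ} (c : Fin n → ℤ) (x : E) :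
    iterT b c x = b ^ n * x + codeSum b c := by
  induction n with
  | zero => simp [iterT, codeSum]
  | succ n ih =>
    have : iterT b c x = T b (c (Fin.last n)) (iterT b (fun i => c i.castSucc) x) := by
      unfold iterT
      rw [List.ofFn_succ', List.concat_eq_append, List.foldl_append]
      rfl
    rw [this, ih, codeSum_succ, T]
    ring

variable {β : ℝ}

/-- The coordinate of a point of `𝕂` at a conjugate. -/
def coordHom (z : GaloisConj β) : KSpace β →+* ℂ :=
  (Pi.evalRingHom _ z).comp (KSpace β).subtype

theorem coordHom_apply (z : GaloisConj β) (x : KSpace β) : coordHom z x = x.1 z := rfl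

theorem coordHom_self (x : KSpace β) : coordHom (GaloisConj.self β) x = firstCoord β x := by
  apply Complex.ext
  · simp [coordHom_apply, firstCoord]
  · have := x.2 (GaloisConj.self β) (by simp [GaloisConj.self])
    simpa [coordHom_apply] using this

/-- The first coordinate as a ring homomorphism. -/
def firstHom (β : ℝ) : KSpace β →+* ℝ where
  toFun := firstCoord β
  map_one' := by simp [firstCoord]
  map_zero' := by simp [firstCoord]
  map_add' x y := by simp [firstCoord]
  map_mul' x y := by
    have h : ((firstCoord β (x * y) : ℝ) : ℂ) = firstCoord β x * firstCoord β y := by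
      rw [← coordHom_self, map_mul, coordHom_self, coordHom_self]
    exact_mod_cast h

theorem firstHom_apply (x : KSpace β) : firstHom β x = firstCoord β x := rfl

theorem firstCoord_betaBar : firstCoord β (betaBar β) = β := by
  simp [firstCoord, betaBar, GaloisConj.self]

theorem coordHom_betaBar (z : GaloisConj β) : coordHom z (betaBar β) = z.1 := rfl

theorem firstCoord_codeSum {n : ℕ} (c : Fin n → ℤ) :
    firstCoord β (codeSum (betaBar β) c) = codeSum β c := by
  rw [← firstHom_apply, map_codeSum, firstHom_apply, firstCoord_betaBar]

theorem firstCoord_T (i : ℤ) (x : KSpace β) :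
    firstCoord β (T (betaBar β) i x) = T β i (firstCoord β x) := by
  simp only [T, ← firstHom_apply, map_add, map_mul, map_intCast]
  rw [firstHom_apply (betaBar β), firstCoord_betaBar]

/-- The ring `ℤ[β]`, embedded in `𝕂` by all conjugates. -/
def lattice (β : ℝ) : Subalgebra ℤ (KSpace β) := Algebra.adjoin ℤ {betaBar β}

theorem betaBar_mem : betaBar β ∈ lattice β := Algebra.subset_adjoin rfl

theorem intCast_mem_lattice (i : ℤ) : (i : KSpace β) ∈ lattice β :=
  (lattice β).intCast_mem i

theorem codeSum_mem_lattice {n : ℕ} (c : Fin n → ℤ) : codeSum (betaBar β) c ∈ lattice β :=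
  Subalgebra.sum_mem _ fun _ _ =>
    Subalgebra.mul_mem _ (intCast_mem_lattice _) (Subalgebra.pow_mem _ betaBar_mem _)

theorem T_mem_lattice {x : KSpace β} (hx : x ∈ lattice β) (i : ℤ) :
    T (betaBar β) i x ∈ lattice β :=
  Subalgebra.add_mem _ (Subalgebra.mul_mem _ betaBar_mem hx) (intCast_mem_lattice _)

theorem spectrumSet_subset_lattice {D : Set ℤ} {x : KSpace β}
    (hx : x ∈ spectrumSet D (betaBar β)) : x ∈ lattice β := by
  obtain ⟨n, c, -, rfl⟩ := hx
  exact codeSum_mem_lattice c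

theorem exists_aeval_of_mem_lattice {x : KSpace β} (hx : x ∈ lattice β) :
    ∃ p : Polynomial ℤ, Polynomial.aeval (betaBar β) p = x := by
  rw [lattice, Algebra.adjoin_singleton_eq_range_aeval] at hx
  exact hx

theorem map_aeval_int {E F : Type*} [CommRing E] [CommRing F] (f : E →+* F) (b : E)
    (p : Polynomial ℤ) : f (Polynomial.aeval b p) = Polynomial.aeval (f b) p :=
  (Polynomial.aeval_algHom_apply f.toIntAlgHom b p).symm

theorem aeval_conj_eq_zero (z : GaloisConj β) {p : Polynomial ℤ}
    (hp : Polynomial.aeval β p = 0) : Polynomial.aeval z.1 p = 0 := by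
  have h1 : Polynomial.aeval β (p.map (algebraMap ℤ ℚ)) = 0 := by
    rwa [Polynomial.aeval_map_algebraMap]
  obtain ⟨q, hq⟩ := minpoly.dvd ℚ β h1
  rw [← Polynomial.aeval_map_algebraMap ℚ, hq, map_mul, z.2, zero_mul]

/-- An integer polynomial that vanishes at β vanishes at all conjugates of β. This carries equations
in ℤ[β] from the line to 𝕂, and so to every other conjugate. -/
theorem firstCoord_injOn : Set.InjOn (firstCoord β) (lattice β : Set (KSpace β)) := by
  intro x hx y hy hxy
  have hmem : x - y ∈ lattice β := Subalgebra.sub_mem _ hx hy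
  obtain ⟨p, hp⟩ := exists_aeval_of_mem_lattice hmem
  have h0 : Polynomial.aeval β p = 0 := by
    have := congrArg (firstHom β) hp
    rw [map_aeval_int, map_sub, firstHom_apply, firstHom_apply, firstHom_apply, hxy, sub_self,
      firstCoord_betaBar] at this
    exact this
  rw [← sub_eq_zero, ← hp]
  refine Subtype.ext (funext fun z => ?_)
  have := aeval_conj_eq_zero z h0
  rw [← coordHom_apply, map_aeval_int, coordHom_betaBar, this]
  rfl

theorem firstCoord_eq_iff {x y : KSpace β} (hx : x ∈ lattice β) (hy : y ∈ lattice β) :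
    firstCoord β x = firstCoord β y ↔ x = y :=
  firstCoord_injOn.eq_iff hx hy

/-- The constant coefficient of the minimal polynomial is nonzero. This is needed for the strict
inequality in `norm_codeSum_lt`. -/
theorem conj_ne_zero (hβ : β ≠ 0) (hint : IsIntegral ℤ β) (z : GaloisConj β) : z.1 ≠ 0 := by
  intro h
  have h1 := z.2
  rw [h, ← Polynomial.coeff_zero_eq_aeval_zero'] at h1
  have hi : IsIntegral ℚ β := hint.tower_top
  refine minpoly.coeff_zero_ne_zero hi hβ ?_
  exact (map_eq_zero (algebraMap ℚ ℂ)).1 h1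

theorem finite_galoisConj (hint : IsIntegral ℤ β) : Finite (GaloisConj β) := by
  have hi : IsIntegral ℚ β := hint.tower_top
  have hfin := Polynomial.rootSet_finite (minpoly ℚ β) ℂ
  refine (hfin.subset fun z hz => ?_ : Set.Finite {z : ℂ | Polynomial.aeval z (minpoly ℚ β) = 0})
  exact Polynomial.mem_rootSet.2 ⟨minpoly.ne_zero hi, hz⟩

/-- There are only finitely many points of the lattice in a bounded set. -/
theorem finite_lattice_bounded (hint : IsIntegral ℤ β) (R : ℝ) :
    {x : KSpace β | x ∈ lattice β ∧ ∀ z, ‖x.1 z‖ ≤ R}.Finite := by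
  have hi : IsIntegral ℚ β := hint.tower_top
  let F := IntermediateField.adjoin ℚ {β}
  have : FiniteDimensional ℚ F := IntermediateField.adjoin.finiteDimensional hi
  have : NumberField F := ⟨⟩
  let θ : F := IntermediateField.AdjoinSimple.gen ℚ β
  have hθ : (θ : ℝ) = β := IntermediateField.AdjoinSimple.coe_gen ℚ β
  have hθint : IsIntegral ℤ θ := by
    rw [← isIntegral_algebraMap_iff (algebraMap F ℝ).injective, show algebraMap F ℝ θ = β from hθ]
    exact hint
  have hfin := NumberField.Embeddings.finite_of_norm_le F ℂ R
  refine Set.Finite.of_finite_image (f := firstCoord β) ?_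
    (firstCoord_injOn.mono fun x hx => hx.1)
  refine (hfin.image (fun y : F => (y : ℝ))).subset ?_
  rintro _ ⟨x, ⟨hx, hR⟩, rfl⟩
  obtain ⟨p, rfl⟩ := exists_aeval_of_mem_lattice hx
  refine ⟨Polynomial.aeval θ p, ⟨?_, fun φ => ?_⟩, ?_⟩
  · exact IsIntegral.of_mem_of_fg _ hθint.fg_adjoin_singleton _
      (Polynomial.aeval_mem_adjoin_singleton ℤ θ)
  -- An embedding φ sends the generator to a conjugate of β, so the bound on the coordinate at φ θ
  -- bounds the image under φ.
  · have hroot : Polynomial.aeval (φ θ) (minpoly ℚ β) = 0 := by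
      have h1 : Polynomial.aeval θ (minpoly ℚ β) = 0 := by
        rw [← IntermediateField.minpoly_gen ℚ β]
        exact minpoly.aeval ℚ _
      have h2 := Polynomial.aeval_algHom_apply φ.toRatAlgHom θ (minpoly ℚ β)
      rw [h1, map_zero] at h2
      exact h2
    rw [map_aeval_int]
    have := hR ⟨φ θ, hroot⟩
    rwa [← coordHom_apply, map_aeval_int, coordHom_betaBar] at this
  · rw [← firstHom_apply, map_aeval_int, firstHom_apply, firstCoord_betaBar]
    exact (map_aeval_int (algebraMap F ℝ) θ p).trans (congrArg (fun t => Polynomial.aeval t p) hθ)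

theorem finite_lattice_box (hint : IsIntegral ℤ β) (D : ℝ) :
    {x : KSpace β | x ∈ lattice β ∧ ∀ z : GaloisConj β, ‖x.1 z‖ < D / |‖z.1‖ - 1|}.Finite := by
  have := finite_galoisConj hint
  obtain ⟨R, hR⟩ := (Set.finite_range fun z : GaloisConj β => D / |‖z.1‖ - 1|).bddAbove
  exact (finite_lattice_bounded hint R).subset fun x hx =>
    ⟨hx.1, fun z => (hx.2 z).le.trans (hR ⟨z, rfl⟩)⟩

theorem norm_codeSum_le (z : ℂ) {D : ℝ} {n : ℕ} (c : Fin n → ℤ) (hc : ∀ i, |(c i : ℝ)| ≤ D) :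
    ‖codeSum z c‖ ≤ D * ∑ k ∈ Finset.range n, ‖z‖ ^ k := by
  induction n with
  | zero => simp [codeSum]
  | succ n ih =>
    rw [codeSum_succ, geom_sum_succ]
    refine (norm_add_le _ _).trans ?_
    rw [norm_mul, Complex.norm_intCast]
    have := mul_le_mul_of_nonneg_left (ih (fun i => c i.castSucc) fun i => hc _) (norm_nonneg z)
    linarith [hc (Fin.last n)]

/-- A partial sum of a geometric series with nonzero ratio is strictly below the full sum 1 / (1 -
‖z‖). -/
theorem norm_codeSum_lt {z : ℂ} (hz0 : z ≠ 0) (hz : ‖z‖ < 1) {D : ℝ} (hD : 0 < D) {n : ℕ}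
    (c : Fin n → ℤ) (hc : ∀ i, |(c i : ℝ)| ≤ D) : ‖codeSum z c‖ < D / |‖z‖ - 1| := by
  refine (norm_codeSum_le z c hc).trans_lt ?_
  rw [abs_of_neg (by linarith), lt_div_iff₀ (by linarith)]
  have := geom_sum_mul ‖z‖ n
  have h2 : 0 < ‖z‖ ^ n := pow_pos (norm_pos_iff.2 hz0) n
  nlinarith

/-- Dividing the code by z ^ n bounds x by a finite part of the series ∑_{k ≥ 1} D ‖z‖^{-k} = D /
(‖z‖ - 1). -/
theorem norm_lt_of_pow_mul_eq {z x : ℂ} (hz : 1 < ‖z‖) {D : ℝ} (hD : 0 < D) {n : ℕ}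
    (c : Fin n → ℤ) (hc : ∀ i, |(c i : ℝ)| ≤ D) (hx : z ^ n * x = codeSum z c) :
    ‖x‖ < D / |‖z‖ - 1| := by
  have h1 := norm_codeSum_le z c hc
  rw [← hx, norm_mul, norm_pow] at h1
  rw [abs_of_pos (by linarith), lt_div_iff₀ (by linarith)]
  have h3 := geom_sum_mul ‖z‖ n
  have h2 : 0 < ‖z‖ ^ n := pow_pos (by linarith) n
  have h4 : ‖z‖ ^ n * (‖x‖ * (‖z‖ - 1)) ≤ D * (‖z‖ ^ n - 1) := by
    rw [← h3]; nlinarith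
  have h5 : ‖z‖ ^ n * (‖x‖ * (‖z‖ - 1)) < ‖z‖ ^ n * D := by nlinarith
  exact lt_of_mul_lt_mul_left h5 h2.le

theorem abs_le_of_mem_digits {i : ℤ} (hi : i ∈ digits) : |(i : ℝ)| ≤ 1 := by
  have : i = -1 ∨ i = 0 ∨ i = 1 := hi
  rcases this with rfl | rfl | rfl <;> simp

theorem abs_sub_le_of_mem_digits {i j : ℤ} (hi : i ∈ digits) (hj : j ∈ digits) :
    |((i - j : ℤ) : ℝ)| ≤ 2 := by
  have h1 := abs_le_of_mem_digits hi
  have h2 := abs_le_of_mem_digits hj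
  push_cast
  exact (abs_sub _ _).trans (by linarith)

theorem coordHom_codeSum (z : GaloisConj β) {n : ℕ} (c : Fin n → ℤ) :
    coordHom z (codeSum (betaBar β) c) = codeSum z.1 c := by
  rw [map_codeSum, coordHom_betaBar]

/-- In the contracting coordinates the spectrum is bounded. -/
theorem norm_coord_lt_of_mem_spectrumSet {z : GaloisConj β} (hz0 : z.1 ≠ 0) (hz : ‖z.1‖ < 1)
    {S : Set ℤ} {D : ℝ} (hD : 0 < D) (hS : ∀ i ∈ S, |(i : ℝ)| ≤ D) {x : KSpace β}
    (hx : x ∈ spectrumSet S (betaBar β)) : ‖x.1 z‖ < D / |‖z.1‖ - 1| := by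
  obtain ⟨n, c, hc, rfl⟩ := hx
  rw [← coordHom_apply, coordHom_codeSum]
  exact norm_codeSum_lt hz0 hz hD c fun i => hS _ (hc i)

end

/-! ### Finiteness, and the passage between 𝕂 and the line -/

variable {β : ℝ}

theorem finite_spectrumBox (hint : IsIntegral ℤ β) (R : ℝ) : (spectrumBox β R).Finite :=
  (finite_lattice_box hint R).subset fun _ hx => ⟨spectrumSet_subset_lattice hx.1, hx.2⟩

theorem exists_mem_spectrumSet_firstCoord {x : ℝ} {S : Set ℤ} (hx : x ∈ spectrumSet S β) :
    ∃ y ∈ spectrumSet S (betaBar β), firstCoord β y = x := by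
  obtain ⟨n, c, hc, rfl⟩ := hx
  exact ⟨_, ⟨n, c, hc, rfl⟩, firstCoord_codeSum c⟩

/-- Such a point is a code, which bounds its contracting coordinates, and β ^ n times it is again a
code, which bounds the expanding ones. The second fact is known on the line and is lifted to 𝕂
before being read at the other conjugates. -/
theorem finite_returnSet (hβ : β ≠ 0) (hint : IsIntegral ℤ β)
    (hconj : ∀ z : GaloisConj β, ‖(z : ℂ)‖ ≠ 1) : (returnSet β).Finite := by
  refine ((finite_spectrumBox hint 1).image (firstCoord β)).subset ?_
  rintro x ⟨m, n, hm, hn⟩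
  obtain ⟨c, hc, rfl⟩ := (count_pos_iff β m x).1 hm
  obtain ⟨e, he, hce⟩ := (count_pos_iff β n _).1 hn
  refine ⟨codeSum (betaBar β) c, ⟨⟨m, c, hc, rfl⟩, fun z => ?_⟩, firstCoord_codeSum c⟩
  rcases lt_or_gt_of_ne (hconj z) with hz | hz
  · exact norm_coord_lt_of_mem_spectrumSet (conj_ne_zero hβ hint z) hz one_pos
      (fun i hi => abs_le_of_mem_digits hi) ⟨m, c, hc, rfl⟩
  · refine norm_lt_of_pow_mul_eq (n := n) hz one_pos (fun i => -e i) (fun i => ?_) ?_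
    · simpa using abs_le_of_mem_digits (he i)
    · have h1 : betaBar β ^ n * codeSum (betaBar β) c = codeSum (betaBar β) (fun i => -e i) := by
        rw [← firstCoord_eq_iff (Subalgebra.mul_mem _ (Subalgebra.pow_mem _ betaBar_mem _)
          (codeSum_mem_lattice c)) (codeSum_mem_lattice _), firstCoord_codeSum, ← firstHom_apply,
          map_mul, map_pow, firstHom_apply, firstHom_apply, firstCoord_betaBar, firstCoord_codeSum]
        have : codeSum β (fun i => -e i) = -codeSum β e := by simp [codeSum]
        rw [this, hce, neg_neg]
      have h2 := congrArg (coordHom z) h1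
      rw [map_mul, map_pow, coordHom_betaBar, coordHom_codeSum, coordHom_codeSum] at h2
      rw [← coordHom_apply, coordHom_codeSum]
      exact h2

theorem count_betaBar {x : KSpace β} (hx : x ∈ lattice β) (n : ℕ) :
    count (betaBar β) n x = count β n (firstCoord β x) := by
  refine Nat.card_congr (Equiv.subtypeEquivRight fun p => ?_)
  change pairSum (betaBar β) n p = x ↔ pairSum β n p = firstCoord β x
  rw [pairSum_eq_codeSum, pairSum_eq_codeSum, ← firstCoord_codeSum,
    firstCoord_eq_iff (codeSum_mem_lattice _) hx]

/-- Codes lie in the lattice. Points off it need separate treatment, since their first coordinate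
may still be a code. -/
theorem count_betaBar_eq_zero {x : KSpace β} (hx : x ∉ lattice β) (n : ℕ) :
    count (betaBar β) n x = 0 := by
  by_contra h
  obtain ⟨c, -, rfl⟩ := (count_pos_iff _ n x).1 (Nat.pos_of_ne_zero h)
  exact hx (codeSum_mem_lattice c)

theorem muBar_eq_mu {x : KSpace β} (hx : x ∈ lattice β) : muBar β x = mu β (firstCoord β x) := by
  simp only [muBar, mu, limitMass, count_betaBar hx]

theorem transMatrix_betaBar {ι : Type*} {v : ι → KSpace β} (hv : ∀ m, v m ∈ lattice β) (i : ℤ) :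
    transMatrix (betaBar β) v i = transMatrix β (fun m => firstCoord β (v m)) i := by
  ext m l
  have h : ∀ j, T β j (firstCoord β (v m)) = firstCoord β (v l) ↔ T (betaBar β) j (v m) = v l :=
    fun j => by rw [← firstCoord_T, firstCoord_eq_iff (T_mem_lattice (hv m) j) (hv l)]
  simp only [transMatrix, Matrix.of_apply]
  rw [← propext (h (1 - i)), ← propext (h (-1 - i)), ← propext (h (-i))]

theorem zero_mem_spectrumSet {E : Type*} [CommRing E] (b : E) (S : Set ℤ) :
    0 ∈ spectrumSet S b := ⟨0, Fin.elim0, fun i => i.elim0, by simp [codeSum]⟩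

/-- At an expanding conjugate z one has ‖z‖‖x_z‖ < 1 / (‖z‖ - 1) + 1 = ‖z‖ / (‖z‖ - 1); at a
contracting one the whole spectrum obeys the bound. So the box is closed under preimages within the
spectrum, as `matRadius_transMatrix` requires. -/
theorem preimage_mem_spectrumBox (hβ : β ≠ 0) (hint : IsIntegral ℤ β)
    (hconj : ∀ z : GaloisConj β, ‖(z : ℂ)‖ ≠ 1) {x : KSpace β}
    (hx : x ∈ spectrumSet digits (betaBar β)) {j : ℤ} (hj : j ∈ digits)
    (hT : T (betaBar β) j x ∈ spectrumBox β 1) : x ∈ spectrumBox β 1 := by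
  refine ⟨hx, fun z => ?_⟩
  rcases lt_or_gt_of_ne (hconj z) with hz | hz
  · exact norm_coord_lt_of_mem_spectrumSet (conj_ne_zero hβ hint z) hz one_pos
      (fun i hi => abs_le_of_mem_digits hi) hx
  · have h1 := hT.2 z
    have h2 : (T (betaBar β) j x).1 z = z.1 * x.1 z + (j : ℂ) := by
      rw [← coordHom_apply, T, map_add, map_mul, coordHom_betaBar, map_intCast, coordHom_apply]
    rw [h2, abs_of_pos (by linarith), lt_div_iff₀ (by linarith)] at h1
    rw [abs_of_pos (by linarith), lt_div_iff₀ (by linarith)]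
    have h3 : ‖z.1‖ * ‖x.1 z‖ ≤ ‖z.1 * x.1 z + (j : ℂ)‖ + 1 := by
      rw [← norm_mul]
      have := norm_sub_le (z.1 * x.1 z + (j : ℂ)) (j : ℂ)
      rw [add_sub_cancel_right, Complex.norm_intCast] at this
      linarith [abs_le_of_mem_digits hj]
    have h4 : ‖z.1‖ * (‖x.1 z‖ * (‖z.1‖ - 1)) < ‖z.1‖ * 1 := by nlinarith
    exact lt_of_mul_lt_mul_left h4 (by linarith)

/-- The normalized counts with the growth rate `lam β`, and their limits. -/
theorem lam_spec (hβ : β ≠ 0) (hint : IsIntegral ℤ β)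
    (hconj : ∀ z : GaloisConj β, ‖(z : ℂ)‖ ≠ 1) :
    1 < lam β ∧ (∀ n, (count β n 0 : ℝ) ≤ lam β ^ n) ∧
      (∀ x, Tendsto (fun n => (count β n x : ℝ) / lam β ^ n) atTop (𝓝 (mu β x))) ∧
      (∀ x ∈ spectrumSet digits β, 0 < mu β x) ∧
      (∀ x, x ∉ spectrumSet digits β → mu β x = 0) ∧
      (∀ x, transfer β (mu β) x = lam β * mu β x) := by
  obtain ⟨L, C, hL, hC, hLC⟩ := exists_count_growth hβ (finite_returnSet hβ hint hconj)
  choose ν hν using exists_tendsto_count hβ hL hC hLC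
  have hpos : ∀ x ∈ spectrumSet digits β, 0 < ν x := fun x hx => limit_pos hβ hL hC hLC hx (hν x)
  have hzero : ∀ x, x ∉ spectrumSet digits β → ν x = 0 := fun x hx => limit_eq_zero hx (hν x)
  have htr := transfer_limit hβ hL hν
  -- The growth rate was found without a matrix; here it is identified with the spectral radius on
  -- the box.
  have hlam : lam β = L := by
    have hfin := finite_spectrumBox hint 1
    unfold lam
    rw [dif_pos hfin]
    have hlat : ∀ x : spectrumBox β 1, (x : KSpace β) ∈ lattice β := fun x =>
      spectrumSet_subset_lattice x.2.1
    rw [transMatrix_betaBar hlat]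
    let _ : Fintype (spectrumBox β 1) := hfin.fintype
    refine matRadius_transMatrix hβ hL (fun n => (hLC n).1) htr hzero
      (hpos 0 (zero_mem_spectrumSet β _)) ?_ ?_ ?_
    · exact fun x y hxy => Subtype.ext ((firstCoord_eq_iff (hlat x) (hlat y)).1 hxy)
    · refine ⟨⟨0, zero_mem_spectrumSet _ _, fun z => ?_⟩, by simp [firstCoord]⟩
      have := abs_pos.2 (sub_ne_zero.2 (hconj z))
      simpa using this
    · rintro x hx j hj l hl
      obtain ⟨y, hy, rfl⟩ := exists_mem_spectrumSet_firstCoord hx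
      have hT : T (betaBar β) j y = l := by
        rw [← firstCoord_eq_iff (T_mem_lattice (spectrumSet_subset_lattice hy) j) (hlat l),
          firstCoord_T]
        exact hl
      exact ⟨⟨y, preimage_mem_spectrumBox hβ hint hconj hy hj (hT ▸ l.2)⟩, rfl⟩
  have hmu : mu β = ν := funext fun x => by
    simp only [mu, limitMass, hlam]
    exact (hν x).limUnder_eq
  rw [hlam, hmu]
  refine ⟨?_, fun n => (hLC n).1, hν, hpos, hzero, htr⟩
  -- The loop T_0 at 0 has weight 2, so in fact L ≥ 2.
  have h1 : (2 : ℝ) ≤ count β 1 0 := by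
    rw [count_succ hβ]
    simp [transfer, count_zero, hβ]
  have h2 := (hLC 1).1
  rw [pow_one] at h2
  linarith

theorem tendsto_muBar (hβ : β ≠ 0) (hint : IsIntegral ℤ β)
    (hconj : ∀ z : GaloisConj β, ‖(z : ℂ)‖ ≠ 1) (x : KSpace β) :
    Tendsto (fun n : ℕ => (count (betaBar β) n x : ℝ) / lam β ^ n) atTop (𝓝 (muBar β x)) := by
  by_cases hx : x ∈ lattice β
  · rw [muBar_eq_mu hx]
    simp only [count_betaBar hx]
    exact (lam_spec hβ hint hconj).2.2.1 _
  · simp only [muBar, limitMass, count_betaBar_eq_zero hx, Nat.cast_zero, zero_div]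
    rw [tendsto_const_nhds.limUnder_eq]
    exact tendsto_const_nhds

/-- A finite set enumerated with a given first element. -/
theorem exists_enumeration {α : Type*} {s : Set α} (hs : s.Finite) {a : α} (ha : a ∈ s) :
    ∃ (k : ℕ) (v : Fin (k + 1) → α), Function.Injective v ∧ Set.range v = s ∧ v 0 = a := by
  obtain ⟨n, f, hf, hr⟩ := hs.fin_param
  rw [← hr] at ha
  obtain ⟨i, rfl⟩ := ha
  rcases n with _ | k
  · exact i.elim0
  · refine ⟨k, f ∘ Equiv.swap 0 i, hf.comp (Equiv.injective _), ?_, by simp⟩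
    rw [(Equiv.surjective _).range_comp, hr]

/-! ### The set Δ and its closure under preimages -/

theorem Delta_subset_lattice {x : KSpace β} (hx : x ∈ Delta (betaBar β)) : x ∈ lattice β := by
  obtain ⟨p, hp, q, hq, -, rfl⟩ := hx
  exact Subalgebra.sub_mem _ (spectrumSet_subset_lattice hp) (spectrumSet_subset_lattice hq)

/-- Contracting coordinates are differences of two bounded ones. At expanding ones β̄ ^ n (x - y) is
a code whose digits are differences of two digits, whence the box with constant 2. -/
theorem finite_Delta (hβ : β ≠ 0) (hint : IsIntegral ℤ β)
    (hconj : ∀ z : GaloisConj β, ‖(z : ℂ)‖ ≠ 1) : (Delta (betaBar β)).Finite := by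
  refine (finite_lattice_box hint 2).subset fun x hx => ⟨Delta_subset_lattice hx, fun z => ?_⟩
  obtain ⟨p, hp, q, hq, ⟨n, c, e, hc, he, hce⟩, rfl⟩ := hx
  rcases lt_or_gt_of_ne (hconj z) with hz | hz
  · have h := fun y hy => norm_coord_lt_of_mem_spectrumSet (x := y) (conj_ne_zero hβ hint z) hz
      one_pos (fun i hi => abs_le_of_mem_digits hi) hy
    have h1 := h p hp
    have h2 := h q hq
    rw [← coordHom_apply, map_sub, coordHom_apply, coordHom_apply]
    refine (norm_sub_le _ _).trans_lt ((add_lt_add h1 h2).trans_eq ?_)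
    ring
  · refine norm_lt_of_pow_mul_eq (n := n) hz two_pos (fun i => e i - c i)
      (fun i => abs_sub_le_of_mem_digits (he i) (hc i)) ?_
    have h1 : betaBar β ^ n * (p - q) = codeSum (betaBar β) (fun i => e i - c i) := by
      have h2 : codeSum (betaBar β) (fun i => e i - c i) =
          codeSum (betaBar β) e - codeSum (betaBar β) c := by
        simp [codeSum, sub_mul, Finset.sum_sub_distrib]
      rw [iterT_eq, iterT_eq] at hce
      rw [h2]
      linear_combination hce
    have h2 := congrArg (coordHom z) h1
    rwa [map_mul, map_pow, coordHom_betaBar, coordHom_codeSum] at h2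

theorem zero_mem_Delta {E : Type*} [CommRing E] (b : E) : (0 : E) ∈ Delta b :=
  ⟨0, zero_mem_spectrumSet b _, 0, zero_mem_spectrumSet b _,
    ⟨0, Fin.elim0, Fin.elim0, fun i => i.elim0, fun i => i.elim0, rfl⟩, by simp⟩

theorem iterT_cons {E : Type*} [CommRing E] (b : E) {n : ℕ} (i : ℤ) (c : Fin n → ℤ) (x : E) :
    iterT b (Fin.cons (α := fun _ => ℤ) i c) x = iterT b c (T b i x) := by
  simp [iterT]

/-- Differences in the spectrum that are mapped into `Δ` belong to `Δ`. -/
theorem mem_Delta_of_T_sub_T_mem {E : Type*} [CommRing E] {b t x : E}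
    (ht : t ∈ spectrumSet digits b) (hx : x ∈ spectrumSet digits b) {i j : ℤ} (hi : i ∈ digits)
    (hj : j ∈ digits) (h : T b j x - T b i t ∈ Delta b) : x - t ∈ Delta b := by
  obtain ⟨p, hp, q, hq, ⟨n, c, e, hc, he, hce⟩, heq⟩ := h
  refine ⟨x, hx, t, ht, ⟨n + 1, Fin.cons (α := fun _ => ℤ) j c, Fin.cons (α := fun _ => ℤ) i e,
    fun k => ?_, fun k => ?_, ?_⟩, rfl⟩
  · refine Fin.cases ?_ (fun k => ?_) k
    · simpa using hj
    · simpa using hc k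
  · refine Fin.cases ?_ (fun k => ?_) k
    · simpa using hi
    · simpa using he k
  · rw [iterT_cons, iterT_cons, iterT_eq, iterT_eq]
    rw [iterT_eq, iterT_eq] at hce
    linear_combination hce + b ^ n * heq

/-- The closure hypothesis of the product formula, stated on the line and proved by lifting t and t
+ x to the spectrum in 𝕂. -/
theorem lift_mem_Delta {t x : ℝ} (ht : t ∈ spectrumSet digits β)
    (htx : t + x ∈ spectrumSet digits β) {i j : ℤ} (hi : i ∈ digits) (hj : j ∈ digits)
    {y : KSpace β} (hy : y ∈ Delta (betaBar β)) (h : β * x + j - i = firstCoord β y) :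
    ∃ w ∈ Delta (betaBar β), firstCoord β w = x := by
  obtain ⟨t', ht', rfl⟩ := exists_mem_spectrumSet_firstCoord ht
  obtain ⟨s, hs, hsx⟩ := exists_mem_spectrumSet_firstCoord htx
  have hls := spectrumSet_subset_lattice hs
  have hlt := spectrumSet_subset_lattice ht'
  refine ⟨s - t', mem_Delta_of_T_sub_T_mem ht' hs hi hj ?_, ?_⟩
  · suffices T (betaBar β) j s - T (betaBar β) i t' = y by rwa [this]
    rw [← firstCoord_eq_iff (Subalgebra.sub_mem _ (T_mem_lattice hls _) (T_mem_lattice hlt _))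
      (Delta_subset_lattice hy), ← firstHom_apply, map_sub, firstHom_apply, firstHom_apply,
      firstCoord_T, firstCoord_T, hsx, T, T, ← h]
    ring
  · rw [← firstHom_apply, map_sub, firstHom_apply, firstHom_apply, hsx]
    ring

/-- The eigenvector, the spectral radius and the product formula for the transition matrices of a
finite set of translations on the line. -/
theorem translation_spec (hβ : β ≠ 0) (hint : IsIntegral ℤ β)
    (hconj : ∀ z : GaloisConj β, ‖(z : ℂ)‖ ≠ 1) {ι : Type*} [Fintype ι] [DecidableEq ι] {d : ι → ℝ}
    (hd : Function.Injective d) (hd0 : (0 : ℝ) ∈ Set.range d)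
    (hcl : ∀ t ∈ spectrumSet digits β, ∀ x, t + x ∈ spectrumSet digits β → ∀ i ∈ digits,
      ∀ j ∈ digits, ∀ l, β * x + j - i = d l → x ∈ Set.range d)
    {A : ℤ → Matrix ι ι ℝ} (hA : ∀ i ∈ digits, A i = transMatrix β d i) :
    Matrix.vecMul (fun m => mu β (d m)) (A 0) = lam β • (fun m => mu β (d m)) ∧
      matRadius (A 0) = lam β ∧ ∀ (n : ℕ) (c : Fin n → ℤ), (∀ i, c i ∈ digits) → ∀ l,
        Matrix.vecMul (fun m => mu β (d m)) (List.ofFn fun i => A (c i)).prod l =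
          lam β ^ n * mu β (codeSum β c + d l) := by
  obtain ⟨h1, hcount, -, hpos, hzero, htr⟩ := lam_spec hβ hint hconj
  have hprod : ∀ (n : ℕ) (c : Fin n → ℤ), (∀ i, c i ∈ digits) → ∀ l,
      Matrix.vecMul (fun m => mu β (d m)) (List.ofFn fun i => A (c i)).prod l =
        lam β ^ n * mu β (codeSum β c + d l) := fun n c hc l =>
    vecMul_prod hβ hd htr hzero hcl hA c hc l
  have h0 : (0 : ℤ) ∈ digits := by simp [digits]
  refine ⟨funext fun l => ?_, ?_, hprod⟩
  -- The eigenvector equation is the product formula for the one-letter word 0.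
  · simpa [codeSum] using hprod 1 (fun _ => 0) (fun _ => h0) l
  · rw [hA 0 h0]
    refine matRadius_transMatrix hβ (by linarith) hcount htr hzero
      (hpos 0 (zero_mem_spectrumSet β _)) hd hd0 fun x hx j hj l hl => ?_
    exact hcl 0 (zero_mem_spectrumSet β _) x (by simpa using hx) 0 h0 j hj l (by simpa using hl)

/-! ### The golden mean -/

section Golden

open Real

theorem isIntegral_goldenRatio : IsIntegral ℤ goldenRatio := by
  refine ⟨Polynomial.X ^ 2 - Polynomial.X - 1, by monicity!, ?_⟩
  simp [goldenRatio_sq]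

theorem golden_conj (z : GaloisConj goldenRatio) :
    z.1 = (goldenRatio : ℂ) ∨ z.1 = (goldenConj : ℂ) := by
  have h := aeval_conj_eq_zero z (p := Polynomial.X ^ 2 - Polynomial.X - 1)
    (by simp [goldenRatio_sq])
  simp only [map_sub, map_pow, Polynomial.aeval_X, map_one] at h
  have h1 : (goldenRatio : ℂ) + goldenConj = 1 := by exact_mod_cast goldenRatio_add_goldenConj
  have h2 : (goldenRatio : ℂ) * goldenConj = -1 := by exact_mod_cast goldenRatio_mul_goldenConj
  have : (z.1 - goldenRatio) * (z.1 - goldenConj) = 0 := by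
    linear_combination h - z.1 * h1 + h2
  rcases mul_eq_zero.1 this with h | h
  · exact Or.inl (sub_eq_zero.1 h)
  · exact Or.inr (sub_eq_zero.1 h)

theorem norm_golden_conj (z : GaloisConj goldenRatio) :
    (z.1 = (goldenRatio : ℂ) ∧ 1 < ‖z.1‖) ∨ ‖z.1‖ < 1 := by
  rcases golden_conj z with h | h
  · refine Or.inl ⟨h, ?_⟩
    rw [h, Complex.norm_real, Real.norm_eq_abs, abs_of_pos goldenRatio_pos]
    exact one_lt_goldenRatio
  · refine Or.inr ?_
    rw [h, Complex.norm_real, Real.norm_eq_abs, abs_of_neg goldenConj_neg]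
    linarith [neg_one_lt_goldenConj]

theorem abs_le_two_of_mem {i : ℤ} (hi : i ∈ ({-2, -1, 0, 1, 2} : Set ℤ)) : |(i : ℝ)| ≤ 2 := by
  have : i = -2 ∨ i = -1 ∨ i = 0 ∨ i = 1 ∨ i = 2 := hi
  rcases this with rfl | rfl | rfl | rfl | rfl <;> norm_num

/-- Since 1 / (φ - 1) = φ, the interval (-2φ, 2φ) is the box with constant 2 at φ; the other
conjugate is contracting and needs no condition. -/
theorem finite_goldenV : goldenV.Finite := by
  refine ((finite_lattice_box isIntegral_goldenRatio 2).image (firstCoord goldenRatio)).subset ?_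
  rintro x ⟨hx, hlo, hhi⟩
  obtain ⟨y, hy, rfl⟩ := exists_mem_spectrumSet_firstCoord hx
  refine ⟨y, ⟨spectrumSet_subset_lattice hy, fun z => ?_⟩, rfl⟩
  rcases norm_golden_conj z with ⟨h, h1⟩ | h
  · have hz : z = GaloisConj.self goldenRatio := Subtype.ext h
    rw [← coordHom_apply, hz, coordHom_self, Complex.norm_real, Real.norm_eq_abs]
    have h3 : ‖(GaloisConj.self goldenRatio).1‖ = goldenRatio := by
      change ‖((goldenRatio : ℝ) : ℂ)‖ = _
      rw [Complex.norm_real, Real.norm_eq_abs, abs_of_pos goldenRatio_pos]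
    have h4 := one_lt_goldenRatio
    rw [h3, abs_of_pos (sub_pos.2 h4), lt_div_iff₀ (sub_pos.2 h4)]
    have h5 := abs_lt.2 ⟨hlo, hhi⟩
    nlinarith [goldenRatio_sq]
  · exact norm_coord_lt_of_mem_spectrumSet (conj_ne_zero goldenRatio_ne_zero isIntegral_goldenRatio z)
      h two_pos (fun i hi => abs_le_two_of_mem hi) hy

theorem zero_mem_goldenV : (0 : ℝ) ∈ goldenV :=
  ⟨zero_mem_spectrumSet _ _, by linarith [goldenRatio_pos], by linarith [goldenRatio_pos]⟩

end Golden

/-- A code can be lengthened by leading zeros. -/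
theorem exists_code_add {E : Type*} [CommRing E] (b : E) {n : ℕ} (c : Fin n → ℤ)
    (hc : ∀ i, c i ∈ digits) (k : ℕ) :
    ∃ e : Fin (n + k) → ℤ, (∀ i, e i ∈ digits) ∧ codeSum b e = codeSum b c := by
  induction k with
  | zero => exact ⟨c, hc, rfl⟩
  | succ k ih =>
    obtain ⟨e, he, h⟩ := ih
    refine ⟨Fin.cons (α := fun _ => ℤ) 0 e, fun i => ?_, ?_⟩
    · refine Fin.cases ?_ (fun i => ?_) i
      · simp [digits]
      · simpa using he i
    · have := iterT_cons b 0 e 0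
      rw [iterT_eq, iterT_eq, h] at this
      simpa [T] using this

theorem sub_mem_spectrumSet {E : Type*} [CommRing E] {b s t : E} (hs : s ∈ spectrumSet digits b)
    (ht : t ∈ spectrumSet digits b) : s - t ∈ spectrumSet {-2, -1, 0, 1, 2} b := by
  obtain ⟨n, c, hc, rfl⟩ := hs
  obtain ⟨m, e, he, rfl⟩ := ht
  obtain ⟨c', hc', h1⟩ := exists_code_add b c hc m
  obtain ⟨e', he', h2⟩ := exists_code_add b e he n
  rw [← h1, ← h2]
  clear h1 h2
  -- The padded words have lengths n + m and m + n, which must become the same type before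
  -- subtraction.
  generalize hN : m + n = N at e'
  obtain rfl : N = n + m := by omega
  refine ⟨n + m, fun i => c' i - e' i, fun i => ?_, by
    simp [codeSum, sub_mul, Finset.sum_sub_distrib]⟩
  have h1 : c' i = -1 ∨ c' i = 0 ∨ c' i = 1 := hc' i
  have h2 : e' i = -1 ∨ e' i = 0 ∨ e' i = 1 := he' i
  rcases h1 with h1 | h1 | h1 <;> rcases h2 with h2 | h2 | h2 <;> simp [h1, h2]

/-- A preimage satisfies φ|x| < 2φ + 2 = 2φ², so it stays in the interval. This closure is all that
the product formula needs. -/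
theorem golden_closed {t x : ℝ} (ht : t ∈ spectrumSet digits Real.goldenRatio)
    (htx : t + x ∈ spectrumSet digits Real.goldenRatio) {i j : ℤ} (hi : i ∈ digits)
    (hj : j ∈ digits) (h : Real.goldenRatio * x + j - i ∈ goldenV) : x ∈ goldenV := by
  have h1 := sub_mem_spectrumSet htx ht
  rw [add_sub_cancel_left] at h1
  refine ⟨h1, ?_⟩
  have h2 := abs_lt.2 h.2
  have h3 := abs_sub_le_of_mem_digits hj hi
  push_cast at h3
  have h4 : |Real.goldenRatio * x| ≤ |Real.goldenRatio * x + j - i| + |(j : ℝ) - i| := by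
    have := abs_sub (Real.goldenRatio * x + j - i) ((j : ℝ) - i)
    rwa [show Real.goldenRatio * x + j - i - ((j : ℝ) - i) = Real.goldenRatio * x by ring] at this
  rw [abs_mul, abs_of_pos Real.goldenRatio_pos] at h4
  refine abs_lt.1 ?_
  have h5 : Real.goldenRatio * |x| < Real.goldenRatio * (2 * Real.goldenRatio) := by
    nlinarith [Real.goldenRatio_sq]
  exact lt_of_mul_lt_mul_left h5 Real.goldenRatio_pos.le

end SpectraMeasure

/-! ### The main theorem -/

open SpectraMeasure in
theorem theorem2 :
    -- the general case
    (∀ β : ℝ, 1 < β → β < 2 → IsIntegral ℤ β → (∀ z : GaloisConj β, ‖(z : ℂ)‖ ≠ 1) →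
      -- the constant and the measures, upstairs and on the line
      ((spectrumBox β 1).Finite ∧ 1 < lam β ∧
        (∀ x : KSpace β, Tendsto (fun n : ℕ => (count (betaBar β) n x : ℝ) / lam β ^ n) atTop
          (𝓝 (muBar β x))) ∧
        (∀ x ∈ spectrumSet digits (betaBar β), 0 < muBar β x) ∧
        (∀ x : ℝ, Tendsto (fun n : ℕ => (count β n x : ℝ) / lam β ^ n) atTop (𝓝 (mu β x))) ∧
        (∀ x ∈ spectrumSet digits β, 0 < mu β x)) ∧
      -- the translations `v`, the row vector `W` and the matrices `A_{-1}, A_0, A_1`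
      ∃ (k : ℕ) (v : Fin (k + 1) → KSpace β) (W : Fin (k + 1) → ℝ)
        (A : ℤ → Matrix (Fin (k + 1)) (Fin (k + 1)) ℝ),
        Function.Injective v ∧ Set.range v = Delta (betaBar β) ∧ v 0 = 0 ∧
        (∀ i, W i = muBar β (v i)) ∧
        (∀ i ∈ digits, A i = transMatrix (betaBar β) v i) ∧
        Matrix.vecMul W (A 0) = lam β • W ∧ matRadius (A 0) = lam β ∧
        ∀ (n : ℕ) (c : Fin n → ℤ), (∀ i, c i ∈ digits) →
          muBar β (codeSum (betaBar β) c) =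
            (lam β ^ n)⁻¹ * Matrix.vecMul W (List.ofFn fun i => A (c i)).prod 0 ∧
          mu β (codeSum β c) =
            (lam β ^ n)⁻¹ * Matrix.vecMul W (List.ofFn fun i => A (c i)).prod 0 ∧
          (∀ i, Matrix.vecMul W (List.ofFn fun i => A (c i)).prod i =
            lam β ^ n * muBar β (codeSum (betaBar β) c + v i)) ∧
          (∀ i, Matrix.vecMul W (List.ofFn fun i => A (c i)).prod i =
            lam β ^ n * mu β (codeSum β c + firstCoord β (v i)))) ∧
    -- the golden mean, with translations on the line
    (∃ (k : ℕ) (v : Fin (k + 1) → ℝ) (W : Fin (k + 1) → ℝ)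
        (M : ℤ → Matrix (Fin (k + 1)) (Fin (k + 1)) ℝ),
        Function.Injective v ∧ Set.range v = goldenV ∧ v 0 = 0 ∧
        (∀ i, W i = mu Real.goldenRatio (v i)) ∧
        (∀ i ∈ digits, M i = transMatrix Real.goldenRatio v i) ∧
        Matrix.vecMul W (M 0) = lam Real.goldenRatio • W ∧
        matRadius (M 0) = lam Real.goldenRatio ∧
        ∀ (n : ℕ) (c : Fin n → ℤ), (∀ i, c i ∈ digits) →
          mu Real.goldenRatio (codeSum Real.goldenRatio c) =
            (lam Real.goldenRatio ^ n)⁻¹ *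
              Matrix.vecMul W (List.ofFn fun i => M (c i)).prod 0 ∧
          (∀ i, Matrix.vecMul W (List.ofFn fun i => M (c i)).prod i =
            lam Real.goldenRatio ^ n * mu Real.goldenRatio (codeSum Real.goldenRatio c + v i))) := by
  refine ⟨fun β h1 _ hint hconj => ?_, ?_⟩
  · have hβ : β ≠ 0 := by linarith
    obtain ⟨hlam, -, hmu, hpos, -, -⟩ := lam_spec hβ hint hconj
    refine ⟨⟨finite_spectrumBox hint 1, hlam, tendsto_muBar hβ hint hconj, fun x hx => ?_, hmu,
      hpos⟩, ?_⟩
    · obtain ⟨n, c, hc, rfl⟩ := hx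
      rw [muBar_eq_mu (codeSum_mem_lattice c), firstCoord_codeSum]
      exact hpos _ ⟨n, c, hc, rfl⟩
    obtain ⟨k, v, hinj, hrange, hv0⟩ :=
      exists_enumeration (finite_Delta hβ hint hconj) (zero_mem_Delta (betaBar β))
    have hvD : ∀ m, v m ∈ Delta (betaBar β) := fun m => hrange ▸ Set.mem_range_self m
    have hv : ∀ m, v m ∈ lattice β := fun m => Delta_subset_lattice (hvD m)
    have hd0 : firstCoord β (v 0) = 0 := by rw [hv0]; simp [firstCoord]
    obtain ⟨hW, hrad, hprod⟩ := translation_spec hβ hint hconj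
      (d := fun m => firstCoord β (v m)) (A := transMatrix (betaBar β) v)
      (fun m l h => hinj ((firstCoord_eq_iff (hv m) (hv l)).1 h)) ⟨0, hd0⟩
      (fun t ht x htx i hi j hj l h => by
        obtain ⟨w, hw, rfl⟩ := lift_mem_Delta ht htx hi hj (hvD l) h
        rw [← hrange] at hw
        obtain ⟨m, rfl⟩ := hw
        exact ⟨m, rfl⟩)
      (fun i _ => transMatrix_betaBar hv i)
    refine ⟨k, v, fun m => mu β (firstCoord β (v m)), transMatrix (betaBar β) v, hinj, hrange, hv0,
      fun i => (muBar_eq_mu (hv i)).symm, fun _ _ => rfl, hW, hrad, fun n c hc => ?_⟩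
    have hL : lam β ^ n ≠ 0 := pow_ne_zero n (by linarith)
    have hmem := codeSum_mem_lattice (β := β) c
    -- The translation with index 0 is zero, so this entry is the mass at the code itself.
    have hx : mu β (codeSum β c) = (lam β ^ n)⁻¹ * Matrix.vecMul
        (fun m => mu β (firstCoord β (v m)))
        (List.ofFn fun i => transMatrix (betaBar β) v (c i)).prod 0 := by
      rw [hprod n c hc 0, hd0, add_zero, inv_mul_cancel_left₀ hL]
    refine ⟨?_, hx, fun i => ?_, hprod n c hc⟩
    · rw [muBar_eq_mu hmem, firstCoord_codeSum, hx]
    · rw [hprod n c hc i, muBar_eq_mu (Subalgebra.add_mem _ hmem (hv i)), ← firstHom_apply (_ + _),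
        map_add, firstHom_apply, firstHom_apply, firstCoord_codeSum]
  · have hconj : ∀ z : GaloisConj Real.goldenRatio, ‖(z : ℂ)‖ ≠ 1 := fun z => by
      rcases norm_golden_conj z with ⟨-, h⟩ | h
      · exact h.ne'
      · exact h.ne
    obtain ⟨k, v, hinj, hrange, hv0⟩ := exists_enumeration finite_goldenV zero_mem_goldenV
    have hvV : ∀ m, v m ∈ goldenV := fun m => hrange ▸ Set.mem_range_self m
    have hlam := (lam_spec Real.goldenRatio_ne_zero isIntegral_goldenRatio hconj).1
    obtain ⟨hW, hrad, hprod⟩ := translation_spec Real.goldenRatio_ne_zero isIntegral_goldenRatio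
      hconj (d := v) (A := transMatrix Real.goldenRatio v) hinj ⟨0, hv0⟩
      (fun t ht x htx i hi j hj l h => by
        rw [hrange]
        exact golden_closed ht htx hi hj (h ▸ hvV l))
      (fun _ _ => rfl)
    refine ⟨k, v, fun m => mu Real.goldenRatio (v m), transMatrix Real.goldenRatio v, hinj, hrange,
      hv0, fun _ => rfl, fun _ _ => rfl, hW, hrad, fun n c hc => ⟨?_, hprod n c hc⟩⟩
    rw [hprod n c hc 0, hv0, add_zero, inv_mul_cancel_left₀ (pow_ne_zero n (by linarith))]
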